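/- Let $\kappa^-\ge 1$, $\kappa=\kappa^-$ in $D_1=(0,\tfrac12)\times(0,1)$ and $\kappa=1$ in $D_2=(\tfrac12,1)\times(0,1)$. Let $u$ solve $$-\nabla\cdot(\kappa\nabla u)+u=f\ \text{ in } D_1\cup D_2,\qquad u=0\ \text{ on }\partial\Omega,\ \Omega=(0,1)^2,\qquad [u]=[\kappa\,\partial_x u]=0\ \text{ on }\{\tfrac12\}\times(0,1),$$ where $[\cdot]$ is the difference of the one-sided limits as $x\to\tfrac12^{\mp}$, and assume $u|_{\bar D_i}\in C^6(\bar D_i)$ for $i=1,2$. Let $\kappa^*>0$ be the value (an average of $\kappa^-$ and $1$) used for the coefficient in the cells cut by the interface; it does not depend on the mesh. For an integer $M\ge1$ put $N=2M+1$, $h=1/N$, $(x_i,y_j)=(ih,jh)$ for $0\le i,j\le N$. Let $k_i=\kappa^-$ for $1\le i\le M$, $k_{M+1}=\kappa^*$, $k_i=1$ for $M+2\le i\le N$, and for a grid function $v$ and $1\le i,j\le N-1$ let $$L_hv_{i,j}=-\tfrac12k_i(v_{i-1,j-1}+v_{i-1,j+1})+(k_i+k_{i+1}+h^2)v_{i,j}-\tfrac12k_{i+1}(v_{i+1,j-1}+v_{i+1,j+1}).$$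 Let $(u_{i,j})$ solve the five-point scheme $L_hu_{i,j}=h^2f(x_i,y_j)$ for $1\le i,j\le N-1$, with $u_{i,j}=0$ at the boundary nodes. Put $e_{i,j}=u(x_i,y_j)-u_{i,j}$ and $R_{i,j}=L_hu(x_i,y_j)-h^2f(x_i,y_j)$. Split $e=e^{(1)}+e^{(2)}$, where $e^{(1)}$ solves $L_he^{(1)}_{i,j}=R_{i,j}$ for $1\le i,j\le N-1$ with $i\ne M,M+1$, and $e^{(1)}_{i,j}=0$ for $i\in\{M,M+1\}$ and at all boundary nodes. Let $\|v\|_\infty=\max_{0\le i,j\le N}|v_{i,j}|$. Then there is a constant $C$, independent of $M$ (that is, of $h$), such that for all $M\ge1$ $$\|e^{(1)}\|_\infty\le C\,h^2|\ln h|,\qquad \|e^{(2)}\|_\infty\le C\,h|\ln h|.$$ If moreover Assumption I holds, i.e. $\kappa^*=\frac{2\kappa^-}{\kappa^-+1}$ and $\lim_{x\to 1/2^-}\partial_y^2u(x,y)=\lim_{x\to1/2^+}\partial_y^2u(x,y)=0$ for all $y\in(0,1)$, then there is a constant $C$, independent of $M$, such that $\|e^{(2)}\|_\infty\le C\,h^2|\ln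 h|$ for all $M\ge1$. -/

import Mathlib

open Set Filter Topology

noncomputable section

namespace MachFVM

/-! ### The interface problem on the unit square -/

/-- The open left subdomain `(0,1/2) × (0,1)`. -/
def D1 : Set (ℝ × ℝ) := Ioo (0 : ℝ) (1 / 2) ×ˢ Ioo (0 : ℝ) 1

/-- The open right subdomain `(1/2,1) × (0,1)`. -/
def D2 : Set (ℝ × ℝ) := Ioo (1 / 2 : ℝ) 1 ×ˢ Ioo (0 : ℝ) 1

/-- The piecewise constant diffusion coefficient: `km` to the left of the interface
`x = 1/2` and `1` to the right of it. -/
def coeff (km : ℝ) (x _y : ℝ) : ℝ := if x < 1 / 2 then km else 1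

/-- The partial derivative in `x`. -/
def dx (w : ℝ → ℝ → ℝ) (x y : ℝ) : ℝ := deriv (fun s => w s y) x

/-- The partial derivative in `y`. -/
def dy (w : ℝ → ℝ → ℝ) (x y : ℝ) : ℝ := deriv (fun t => w x t) y

/-- The differential operator `-∇·(κ ∇u) + u`. -/
def diffusionOp (km : ℝ) (u : ℝ → ℝ → ℝ) (x y : ℝ) : ℝ :=
  -(dx (fun s t => coeff km s t * dx u s t) x y
    + dy (fun s t => coeff km s t * dy u s t) x y) + u x y

/-- `[ζ] = 0` on the interface `{1/2} × (0,1)`: the left and right limits of `ζ` in the normal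
direction exist and agree. -/
def NoJump (ζ : ℝ → ℝ → ℝ) : Prop :=
  ∀ y ∈ Ioo (0 : ℝ) 1, ∃ l : ℝ,
    Tendsto (fun x => ζ x y) (𝓝[<] (1 / 2 : ℝ)) (𝓝 l) ∧
    Tendsto (fun x => ζ x y) (𝓝[>] (1 / 2 : ℝ)) (𝓝 l)

/-- The space `W` of functions whose restriction to each closed subdomain is of class `C⁶`. -/
def MemW (w : ℝ → ℝ → ℝ) : Prop :=
  ContDiffOn ℝ 6 (fun p : ℝ × ℝ => w p.1 p.2) (closure D1) ∧
  ContDiffOn ℝ 6 (fun p : ℝ × ℝ => w p.1 p.2) (closure D2)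

/-- `u` solves the interface problem with right-hand side `f`: the differential equation holds in
both open subdomains, `u = 0` on the boundary of the unit square, and `[u] = [κ ∂u/∂n] = 0` on the
interface. -/
structure IsInterfaceSolution (km : ℝ) (f u : ℝ → ℝ → ℝ) : Prop where
  equation : ∀ x y : ℝ, (x, y) ∈ D1 ∪ D2 → diffusionOp km u x y = f x y
  boundary : ∀ t ∈ Icc (0 : ℝ) 1, u 0 t = 0 ∧ u 1 t = 0 ∧ u t 0 = 0 ∧ u t 1 = 0
  jump : NoJump u
  jump_flux : NoJump (fun x y => coeff km x y * dx u x y)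

/-- Assumption I: `κ*` is the harmonic average of the two coefficients, and the one-sided limits of
`∂²u/∂y²` at the interface vanish. -/
def AssumptionI (km ks : ℝ) (u : ℝ → ℝ → ℝ) : Prop :=
  ks = 2 * km / (km + 1) ∧
  ∀ y ∈ Ioo (0 : ℝ) 1,
    Tendsto (fun x => dy (dy u) x y) (𝓝[<] (1 / 2 : ℝ)) (𝓝 0) ∧
    Tendsto (fun x => dy (dy u) x y) (𝓝[>] (1 / 2 : ℝ)) (𝓝 0)

/-! ### The five-point scheme on the square grid with `N = 2 M + 1` cells per side

Grid functions are functions `ℕ → ℕ → ℝ`, of which only the values at indices `0 ≤ i, j ≤ N`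
play a role. -/

/-- The number of cells per side. -/
def cells (M : ℕ) : ℕ := 2 * M + 1

/-- The mesh size `h = 1 / N`. -/
def mesh (M : ℕ) : ℝ := 1 / (cells M : ℝ)

/-- The values of a function at the nodes `(x_i, y_j) = (i h, j h)`. -/
def nodal (M : ℕ) (w : ℝ → ℝ → ℝ) (i j : ℕ) : ℝ := w (i * mesh M) (j * mesh M)

/-- The coefficient of the cells between the grid columns `i - 1` and `i`; the cells between the
columns `M` and `M + 1` are cut by the interface and carry `ks`. -/
def cellCoeff (km ks : ℝ) (M i : ℕ) : ℝ :=
  if i ≤ M then km else if i = M + 1 then ks else 1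

/-- The five-point operator `L_h` at an interior node:
`a₁ = a₄ = -(1/2) κ_west`, `a₂ = a₅ = -(1/2) κ_east`, `a₃ = κ_west + κ_east + h²`. -/
def Lh (km ks : ℝ) (M : ℕ) (v : ℕ → ℕ → ℝ) (i j : ℕ) : ℝ :=
  -(1 / 2) * cellCoeff km ks M i * (v (i - 1) (j - 1) + v (i - 1) (j + 1))
    + (cellCoeff km ks M i + cellCoeff km ks M (i + 1) + mesh M ^ 2) * v i j
    - (1 / 2) * cellCoeff km ks M (i + 1) * (v (i + 1) (j - 1) + v (i + 1) (j + 1))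

/-- The index set of the interior nodes. -/
def S0 (M : ℕ) : Set (ℕ × ℕ) := Icc 1 (cells M - 1) ×ˢ Icc 1 (cells M - 1)

/-- The index set of the interior nodes adjacent to the interface (columns `M` and `M + 1`). -/
def SB (M : ℕ) : Set (ℕ × ℕ) := {p | p ∈ S0 M ∧ (p.1 = M ∨ p.1 = M + 1)}

/-- The index set of the interior nodes not adjacent to the interface. -/
def SI (M : ℕ) : Set (ℕ × ℕ) := S0 M \ SB M

/-- A grid function vanishes at all boundary nodes. -/
def ZeroBoundary (M : ℕ) (v : ℕ → ℕ → ℝ) : Prop :=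
  ∀ k ≤ cells M, v 0 k = 0 ∧ v (cells M) k = 0 ∧ v k 0 = 0 ∧ v k (cells M) = 0

/-- `U` solves the five-point scheme with right-hand side `h² f(x_i, y_j)`. -/
def IsSchemeSolution (km ks : ℝ) (f : ℝ → ℝ → ℝ) (M : ℕ) (U : ℕ → ℕ → ℝ) : Prop :=
  (∀ i j : ℕ, (i, j) ∈ S0 M → Lh km ks M U i j = mesh M ^ 2 * nodal M f i j) ∧
  ZeroBoundary M U

/-- The local truncation error `R_{i,j} = L_h u(x_i, y_j) - h² f(x_i, y_j)`. -/
def truncError (km ks : ℝ) (f u : ℝ → ℝ → ℝ) (M i j : ℕ) : ℝ :=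
  Lh km ks M (nodal M u) i j - mesh M ^ 2 * nodal M f i j

/-- `e` is the first part of the error: it satisfies the error equations `L_h e = R` at the
interior nodes not adjacent to the interface, and vanishes at the nodes adjacent to the interface
and at the boundary nodes. -/
def IsFirstErrorPart (km ks : ℝ) (f u : ℝ → ℝ → ℝ) (M : ℕ) (e : ℕ → ℕ → ℝ) : Prop :=
  (∀ i j : ℕ, (i, j) ∈ SI M → Lh km ks M e i j = truncError km ks f u M i j) ∧
  (∀ i j : ℕ, (i, j) ∈ SB M → e i j = 0) ∧
  ZeroBoundary M e

/-- The error `e_{i,j} = u(x_i, y_j) - u_{i,j}`. -/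
def errorVec (u : ℝ → ℝ → ℝ) (M : ℕ) (U : ℕ → ℕ → ℝ) (i j : ℕ) : ℝ := nodal M u i j - U i j

/-- The maximum norm over all nodes of the grid. -/
def maxNorm (M : ℕ) (v : ℕ → ℕ → ℝ) : ℝ :=
  (Finset.range (cells M + 1) ×ˢ Finset.range (cells M + 1)).sup'
    ⟨(0, 0), by simp⟩ (fun p => |v p.1 p.2|)

end MachFVM

end

/-!
The proof bounds the whole error `e = u - U` and the first part `e₁` by the discrete maximum
principle, and gets `e₂ = e - e₁` by the triangle inequality. All bounds come out without the
logarithm, which is harmless because `|log h| ≥ 1` for `h ≤ 1/3`.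

*Stability.* The matrix of the scheme is a strictly diagonally dominant M-matrix, so comparison
functions are available (`nonneg_of_Lh_nonneg`). A barrier depending on the column alone, built from
prescribed decreasing fluxes, stays bounded while `L_h` of it is at least `h²` everywhere and at
least `h` in the two columns next to the interface (`residualScale_le_Lh_barrier`). Hence a residual
`O(hᵏ⁺²)` in general and `O(hᵏ⁺¹)` next to the interface costs only `O(hᵏ)`
(`abs_le_of_abs_Lh_le`).

*Dipoles.* Next to the interface the residual is one power of `h` too large for this, namely
`O(hᵏ)`, but with opposite signs in the two columns. Such a dipole `∓ hᵏ d` is the image under `L_h`,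
up to admissible terms, of the step function that is `0` to the left and `hᵏ d / κ*` to the right of
the cut cells. Subtracting that step leaves an admissible residual (`abs_le_of_dipole`).

*Consistency.* Away from the interface the truncation error is `O(h⁴)`
(`exists_SI_truncError_bound`), which gives `e₁ = O(h²)` at once. Next to the interface one-sided
Taylor expansions on both sides give it up to `O(h³)` (`exists_interface_truncError_bound`). The
terms of first order form a dipole because the flux is continuous, so `e = O(h)`
(`exists_errorVec_bound`). With the harmonic average these terms vanish, and if moreover the second
tangential derivatives vanish at the interface, the terms of second order form a dipole, so
`e = O(h²)` (`exists_errorVec_bound_of_assumptionI`).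
-/

namespace MachFVM

/-! ### Discrete maximum principle and stability -/

lemma cellCoeff_pos {km ks : ℝ} (hkm : 1 ≤ km) (hks : 0 < ks) (M i : ℕ) :
    0 < cellCoeff km ks M i := by
  unfold cellCoeff
  split_ifs <;> linarith

lemma min_le_cellCoeff {km ks : ℝ} (hkm : 1 ≤ km) (M i : ℕ) :
    min 1 ks ≤ cellCoeff km ks M i := by
  unfold cellCoeff
  split_ifs
  · exact (min_le_left _ _).trans hkm
  · exact min_le_right _ _
  · exact min_le_left _ _

lemma mesh_pos (M : ℕ) : 0 < mesh M := by
  unfold mesh cells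
  positivity

lemma cells_mul_mesh (M : ℕ) : (2 * (M : ℝ) + 1) * mesh M = 1 := by
  unfold mesh cells
  push_cast
  field_simp

lemma mesh_le_third {M : ℕ} (hM : 1 ≤ M) : mesh M ≤ 1 / 3 := by
  have h1 := cells_mul_mesh M
  have h2 : (1 : ℝ) ≤ M := by exact_mod_cast hM
  nlinarith [mesh_pos M]

lemma one_le_abs_log_mesh {M : ℕ} (hM : 1 ≤ M) : 1 ≤ |Real.log (mesh M)| := by
  have h3 : Real.log (mesh M) ≤ Real.log (Real.exp (-1)) := by
    refine Real.log_le_log (mesh_pos M) ((mesh_le_third hM).trans ?_)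
    rw [Real.exp_neg, ← one_div]
    exact one_div_le_one_div_of_le (Real.exp_pos _)
      (by linarith [Real.exp_one_lt_d9])
  rw [Real.log_exp] at h3
  rw [abs_of_nonpos (by linarith)]
  linarith

lemma mem_S0 {M i j : ℕ} : (i, j) ∈ S0 M ↔ (1 ≤ i ∧ i ≤ 2 * M) ∧ (1 ≤ j ∧ j ≤ 2 * M) := by
  simp only [S0, cells, mem_prod, mem_Icc, Nat.add_sub_cancel]

/-- Comparison principle for the five-point operator: at a negative minimum the differences to the
four neighbours contribute nonpositively and the zeroth-order term strictly negatively. -/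
lemma nonneg_of_Lh_nonneg {km ks : ℝ} (hkm : 1 ≤ km) (hks : 0 < ks) {M : ℕ} {v : ℕ → ℕ → ℝ}
    (hbd : ∀ k ≤ cells M, 0 ≤ v 0 k ∧ 0 ≤ v (cells M) k ∧ 0 ≤ v k 0 ∧ 0 ≤ v k (cells M))
    (hint : ∀ i j, (i, j) ∈ S0 M → 0 ≤ v i j ∨ 0 ≤ Lh km ks M v i j) {i j : ℕ}
    (hi : i ≤ cells M) (hj : j ≤ cells M) : 0 ≤ v i j := by
  obtain ⟨⟨a, b⟩, hab, hmin⟩ := Finset.exists_min_image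
    (Finset.range (cells M + 1) ×ˢ Finset.range (cells M + 1)) (fun p => v p.1 p.2)
    ⟨(0, 0), by simp⟩
  have hmin' : ∀ i ≤ cells M, ∀ j ≤ cells M, v a b ≤ v i j := fun i hi j hj =>
    hmin (i, j) (by simp; omega)
  refine le_trans ?_ (hmin' i hi j hj)
  by_contra! hneg
  simp only [Finset.mem_product, Finset.mem_range] at hab
  have ha : 1 ≤ a ∧ a ≤ 2 * M := by
    constructor
    · by_contra! h
      obtain rfl : a = 0 := by omega
      linarith [(hbd b (by omega)).1]
    · by_contra! h
      obtain rfl : a = cells M := by unfold cells at *; omega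
      linarith [(hbd b (by omega)).2.1]
  have hb : 1 ≤ b ∧ b ≤ 2 * M := by
    constructor
    · by_contra! h
      obtain rfl : b = 0 := by omega
      linarith [(hbd a (by omega)).2.2.1]
    · by_contra! h
      obtain rfl : b = cells M := by unfold cells at *; omega
      linarith [(hbd a (by omega)).2.2.2]
  rcases hint a b (mem_S0.2 ⟨ha, hb⟩) with h | h
  · linarith
  have k1 := cellCoeff_pos hkm hks M a
  have k2 := cellCoeff_pos hkm hks M (a + 1)
  have hm := mesh_pos M
  have hc : cells M = 2 * M + 1 := rfl
  have n1 := hmin' (a - 1) (by omega) (b - 1) (by omega)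
  have n2 := hmin' (a - 1) (by omega) (b + 1) (by omega)
  have n3 := hmin' (a + 1) (by omega) (b - 1) (by omega)
  have n4 := hmin' (a + 1) (by omega) (b + 1) (by omega)
  have hL : Lh km ks M v a b =
      -(1 / 2 * cellCoeff km ks M a * ((v (a - 1) (b - 1) - v a b) + (v (a - 1) (b + 1) - v a b))
        + 1 / 2 * cellCoeff km ks M (a + 1) *
          ((v (a + 1) (b - 1) - v a b) + (v (a + 1) (b + 1) - v a b)))
        + mesh M ^ 2 * v a b := by
    unfold Lh; ring
  have t1 : 0 ≤ 1 / 2 * cellCoeff km ks M a *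
      ((v (a - 1) (b - 1) - v a b) + (v (a - 1) (b + 1) - v a b)) :=
    mul_nonneg (by positivity) (by linarith)
  have t2 : 0 ≤ 1 / 2 * cellCoeff km ks M (a + 1) *
      ((v (a + 1) (b - 1) - v a b) + (v (a + 1) (b + 1) - v a b)) :=
    mul_nonneg (by positivity) (by linarith)
  have t3 : mesh M ^ 2 * v a b < 0 := mul_neg_of_pos_of_neg (by positivity) hneg
  linarith

/-- The flux prescribed for the barrier between the grid columns `i - 1` and `i`. It decreases by
`h²` at every column and by a further `h` at each of the two columns next to the interface. -/
noncomputable def barrierFlux (M i : ℕ) : ℝ :=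
  -(i * mesh M ^ 2 + (if M + 1 ≤ i then mesh M else 0) + (if M + 2 ≤ i then mesh M else 0))

/-- An upper bound for the barrier. -/
noncomputable def barrierBound (ks : ℝ) : ℝ := 1 + 3 / min 1 ks

/-- The barrier: a function of the column alone, equal to `barrierBound` on the left side of the
square, whose fluxes are `barrierFlux`. -/
noncomputable def barrier (km ks : ℝ) (M i : ℕ) : ℝ :=
  barrierBound ks + ∑ l ∈ Finset.range i, barrierFlux M (l + 1) / cellCoeff km ks M (l + 1)

/-- The size of the residual that the barrier controls: `h` next to the interface, `h²`
elsewhere. -/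
noncomputable def residualScale (M i : ℕ) : ℝ :=
  if i = M ∨ i = M + 1 then mesh M else mesh M ^ 2

lemma barrierFlux_bounds {M i : ℕ} (hi : i ≤ cells M) :
    barrierFlux M i ≤ 0 ∧ -(3 * mesh M) ≤ barrierFlux M i := by
  have h0 := mesh_pos M
  have h1 : (i : ℝ) * mesh M ≤ 1 := by
    rw [← cells_mul_mesh M]
    have : (i : ℝ) ≤ 2 * M + 1 := by exact_mod_cast hi
    gcongr
  have h2 : (i : ℝ) * mesh M ^ 2 ≤ mesh M := by nlinarith
  have h3 : 0 ≤ (i : ℝ) * mesh M ^ 2 := by positivity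
  unfold barrierFlux
  split_ifs <;> constructor <;> linarith

lemma barrier_le {km ks : ℝ} (hkm : 1 ≤ km) (hks : 0 < ks) {M i : ℕ} (hi : i ≤ cells M) :
    barrier km ks M i ≤ barrierBound ks := by
  unfold barrier
  have : ∑ l ∈ Finset.range i, barrierFlux M (l + 1) / cellCoeff km ks M (l + 1) ≤ 0 := by
    refine Finset.sum_nonpos fun l hl => ?_
    rw [Finset.mem_range] at hl
    exact div_nonpos_of_nonpos_of_nonneg (barrierFlux_bounds (by omega)).1
      (cellCoeff_pos hkm hks M _).le
  linarith

lemma one_le_barrier {km ks : ℝ} (hkm : 1 ≤ km) (hks : 0 < ks) {M i : ℕ} (hi : i ≤ cells M) :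
    1 ≤ barrier km ks M i := by
  have hmin : 0 < min 1 ks := lt_min one_pos hks
  have h0 := mesh_pos M
  have hsum : ∑ l ∈ Finset.range i, -(3 * mesh M / min 1 ks) ≤
      ∑ l ∈ Finset.range i, barrierFlux M (l + 1) / cellCoeff km ks M (l + 1) := by
    refine Finset.sum_le_sum fun l hl => ?_
    rw [Finset.mem_range] at hl
    have h1 := (barrierFlux_bounds (M := M) (i := l + 1) (by omega)).2
    have h2 := cellCoeff_pos hkm hks M (l + 1)
    calc -(3 * mesh M / min 1 ks) ≤ -(3 * mesh M / cellCoeff km ks M (l + 1)) := by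
          have := min_le_cellCoeff (ks := ks) hkm M (l + 1)
          gcongr
      _ = -(3 * mesh M) / cellCoeff km ks M (l + 1) := by ring
      _ ≤ _ := by gcongr
  rw [Finset.sum_const, Finset.card_range, nsmul_eq_mul] at hsum
  have h1 : (i : ℝ) * mesh M ≤ 1 := by
    rw [← cells_mul_mesh M]
    have : (i : ℝ) ≤ 2 * M + 1 := by exact_mod_cast hi
    gcongr
  have h2 : (i : ℝ) * -(3 * mesh M / min 1 ks) = -((i : ℝ) * mesh M) * (3 / min 1 ks) := by ring
  have h3 : 0 < 3 / min 1 ks := by positivity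
  unfold barrier barrierBound
  nlinarith

lemma residualScale_le_Lh_barrier {km ks : ℝ} (hkm : 1 ≤ km) (hks : 0 < ks) {M i j : ℕ}
    (hij : (i, j) ∈ S0 M) :
    residualScale M i ≤ Lh km ks M (fun i _ => barrier km ks M i) i j := by
  rw [mem_S0] at hij
  obtain ⟨i, rfl⟩ : ∃ l, i = l + 1 := ⟨i - 1, by omega⟩
  have hb := one_le_barrier hkm hks (M := M) (i := i + 1) (by unfold cells; omega)
  have h0 := mesh_pos M
  have hk1 := (cellCoeff_pos hkm hks M (i + 1)).ne'
  have hk2 := (cellCoeff_pos hkm hks M (i + 1 + 1)).ne'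
  have e1 : barrier km ks M (i + 1) = barrier km ks M i
      + barrierFlux M (i + 1) / cellCoeff km ks M (i + 1) := by
    unfold barrier; rw [Finset.sum_range_succ]; ring
  have e2 : barrier km ks M (i + 1 + 1) = barrier km ks M (i + 1)
      + barrierFlux M (i + 1 + 1) / cellCoeff km ks M (i + 1 + 1) := by
    unfold barrier; rw [Finset.sum_range_succ _ (i + 1)]; ring
  have hL : Lh km ks M (fun i _ => barrier km ks M i) (i + 1) j =
      barrierFlux M (i + 1) - barrierFlux M (i + 1 + 1)
        + mesh M ^ 2 * barrier km ks M (i + 1) := by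
    unfold Lh
    simp only [Nat.add_sub_cancel]
    have e1' : cellCoeff km ks M (i + 1) * (barrier km ks M (i + 1) - barrier km ks M i)
        = barrierFlux M (i + 1) := by rw [e1]; field_simp; ring
    have e2' : cellCoeff km ks M (i + 1 + 1) *
        (barrier km ks M (i + 1 + 1) - barrier km ks M (i + 1))
        = barrierFlux M (i + 1 + 1) := by rw [e2]; field_simp; ring
    rw [← e1', ← e2']
    ring
  have hpos : 0 ≤ mesh M ^ 2 * barrier km ks M (i + 1) := by positivity
  rw [hL]
  unfold residualScale barrierFlux
  push_cast
  split_ifs <;> first | omega | nlinarith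

/-- Stability of the five-point scheme in the maximum norm. -/
lemma abs_le_of_abs_Lh_le {km ks : ℝ} (hkm : 1 ≤ km) (hks : 0 < ks) {M : ℕ} {v : ℕ → ℕ → ℝ}
    {A : ℝ} (hA : 0 ≤ A)
    (hbd : ∀ k ≤ cells M, |v 0 k| ≤ A ∧ |v (cells M) k| ≤ A ∧ |v k 0| ≤ A ∧ |v k (cells M)| ≤ A)
    (hint : ∀ i j, (i, j) ∈ S0 M →
      |v i j| ≤ A ∨ |Lh km ks M v i j| ≤ A * residualScale M i) {i j : ℕ}
    (hi : i ≤ cells M) (hj : j ≤ cells M) : |v i j| ≤ A * barrierBound ks := by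
  have key : ∀ σ : ℝ, |σ| = 1 → 0 ≤ A * barrier km ks M i + σ * v i j := by
    intro σ hσ
    have hle : ∀ x : ℝ, |x| ≤ A → ∀ i ≤ cells M, 0 ≤ A * barrier km ks M i + σ * x := by
      intro x hx i hi
      have h1 : A ≤ A * barrier km ks M i := le_mul_of_one_le_right hA (one_le_barrier hkm hks hi)
      have h2 : |σ * x| ≤ A := by rw [abs_mul, hσ, one_mul]; exact hx
      linarith [neg_abs_le (σ * x)]
    refine nonneg_of_Lh_nonneg hkm hks
      (v := fun i j => A * barrier km ks M i + σ * v i j) (fun k hk => ?_) (fun i j hij => ?_) hi hj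
    · obtain ⟨h1, h2, h3, h4⟩ := hbd k hk
      exact ⟨hle _ h1 _ (Nat.zero_le _), hle _ h2 _ le_rfl, hle _ h3 _ hk, hle _ h4 _ hk⟩
    · have hij' := mem_S0.1 hij
      refine (hint i j hij).imp (fun h => hle _ h _ (by unfold cells; omega)) fun h => ?_
      have h1 := mul_le_mul_of_nonneg_left (residualScale_le_Lh_barrier hkm hks hij) hA
      have h2 : |σ * Lh km ks M v i j| ≤ A * residualScale M i := by
        rw [abs_mul, hσ, one_mul]; exact h
      have h3 : Lh km ks M (fun i j => A * barrier km ks M i + σ * v i j) i j =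
          A * Lh km ks M (fun i _ => barrier km ks M i) i j + σ * Lh km ks M v i j := by
        unfold Lh; ring
      rw [h3]
      linarith [neg_abs_le (σ * Lh km ks M v i j)]
  have h1 := key 1 (by simp)
  have h2 := key (-1) (by simp)
  have h3 := mul_le_mul_of_nonneg_left (barrier_le hkm hks hi) hA
  rw [abs_le]
  constructor <;> linarith

/-- Stability for residuals with a dipole at the interface. A residual `∓ hᵏ d` in the columns `M`
and `M + 1` is produced, up to higher-order terms, by the step `hᵏ d / ks` across the cut cells, so
that it costs a factor `hᵏ` only, not the factor `hᵏ⁻¹` that its size alone would give. -/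
lemma abs_le_of_dipole {km ks : ℝ} (hkm : 1 ≤ km) (hks : 0 < ks) {A : ℝ} (hA : 0 ≤ A) :
    ∃ C : ℝ, ∀ (k M : ℕ) (v : ℕ → ℕ → ℝ) (d : ℕ → ℝ), ZeroBoundary M v →
      (∀ j ≤ cells M, |d j| ≤ A) →
      (∀ j, 1 ≤ j → j ≤ 2 * M → |d (j + 1) + d (j - 1) - 2 * d j| ≤ A * mesh M ^ 2) →
      (∀ i j, (i, j) ∈ SI M → |Lh km ks M v i j| ≤ A * mesh M ^ (k + 2)) →
      (∀ j, 1 ≤ j → j ≤ 2 * M → |Lh km ks M v M j + mesh M ^ k * d j| ≤ A * mesh M ^ (k + 1)) →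
      (∀ j, 1 ≤ j → j ≤ 2 * M →
        |Lh km ks M v (M + 1) j - mesh M ^ k * d j| ≤ A * mesh M ^ (k + 1)) →
      ∀ i ≤ cells M, ∀ j ≤ cells M, |v i j| ≤ C * mesh M ^ k := by
  refine ⟨A * (2 + 3 / ks) * barrierBound ks + A / ks,
    fun k M v d hv hd hd2 hI hM hM1 i hi j hj => ?_⟩
  have h0 := mesh_pos M
  set h := mesh M with hh
  have hle1 : h ≤ 1 := by
    have := cells_mul_mesh M
    rw [← hh] at this
    nlinarith [mul_nonneg (Nat.cast_nonneg (α := ℝ) M) h0.le]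
  have hc : cells M = 2 * M + 1 := rfl
  have hAks : 0 ≤ A / ks := by positivity
  -- The step across the cut cells, whose jump `hᵏ d / ks` carries the flux `hᵏ d`.
  set w : ℕ → ℕ → ℝ := fun i j => if i ≤ M then 0 else h ^ k * d j / ks with hw
  have hwL : ∀ i j, i ≤ M → w i j = 0 := fun i j hi => if_pos hi
  have hwR : ∀ i j, M < i → w i j = h ^ k * d j / ks := fun i j hi => if_neg (by omega)
  have hkM1 : cellCoeff km ks M (M + 1) = ks := by simp [cellCoeff]
  have hk1 : ∀ i, M + 1 < i → cellCoeff km ks M i = 1 := fun i hi => by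
    rw [cellCoeff, if_neg (by omega), if_neg (by omega)]
  have hwle : ∀ i, ∀ j ≤ cells M, |w i j| ≤ A / ks * h ^ k := by
    intro i j hj
    simp only [hw]
    split_ifs
    · simp only [abs_zero]; positivity
    · rw [abs_div, abs_mul, abs_of_pos hks, abs_of_pos (pow_pos h0 k)]
      calc h ^ k * |d j| / ks ≤ h ^ k * A / ks := by gcongr; exact hd j hj
        _ = _ := by ring
  have hLsub : ∀ i j, Lh km ks M (fun i j => v i j - w i j) i j
      = Lh km ks M v i j - Lh km ks M w i j := by
    intro i j; unfold Lh; ring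
  have hA2 : A / ks ≤ A * (2 + 3 / ks) := by
    have : A * (2 + 3 / ks) = 2 * A + 3 * (A / ks) := by ring
    linarith
  have hbdw : ∀ i, ∀ j ≤ cells M, v i j = 0 → |v i j - w i j| ≤ A * (2 + 3 / ks) * h ^ k := by
    intro i j hj h1
    rw [h1, zero_sub, abs_neg]
    exact (hwle i j hj).trans (by gcongr)
  have hpow : 0 < h ^ k := by positivity
  have hp1 : h ^ (k + 1) = h ^ k * h := pow_succ _ _
  have hp2 : h ^ (k + 2) = h ^ k * h ^ 2 := pow_add _ _ _
  have hd2' : ∀ j, 1 ≤ j → j ≤ 2 * M →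
      |1 / 2 * (h ^ k * (d (j + 1) + d (j - 1) - 2 * d j))| ≤ A * (h ^ k * h ^ 2) := by
    intro j h1 h2
    rw [abs_mul, abs_mul, abs_of_pos hpow, abs_of_pos (by norm_num : (0 : ℝ) < 1 / 2)]
    have := mul_le_mul_of_nonneg_left (hd2 j h1 h2) hpow.le
    nlinarith [abs_nonneg (d (j + 1) + d (j - 1) - 2 * d j)]
  have hdj : ∀ j ≤ cells M, |h ^ k * d j| ≤ A * h ^ k := by
    intro j hj
    rw [abs_mul, abs_of_pos hpow, mul_comm]
    exact mul_le_mul_of_nonneg_right (hd j hj) hpow.le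
  have hmain := abs_le_of_abs_Lh_le hkm hks (M := M) (v := fun i j => v i j - w i j)
    (A := A * (2 + 3 / ks) * h ^ k) (by positivity) (fun l hl => ?_) (fun i j hij => Or.inr ?_) hi hj
  · have h1 := hwle i j hj
    have h2 : |v i j| ≤ |v i j - w i j| + |w i j| := by
      simpa using abs_add_le (v i j - w i j) (w i j)
    calc |v i j| ≤ _ := h2
      _ ≤ A * (2 + 3 / ks) * h ^ k * barrierBound ks + A / ks * h ^ k := add_le_add hmain h1
      _ = _ := by ring
  · obtain ⟨h1, h2, h3, h4⟩ := hv l hl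
    exact ⟨hbdw _ _ hl h1, hbdw _ _ hl h2, hbdw _ _ (Nat.zero_le _) h3, hbdw _ _ le_rfl h4⟩
  · have hij' := mem_S0.1 hij
    obtain ⟨⟨hi1, hi2⟩, hj1, hj2⟩ := hij'
    rw [hLsub]
    have hq := hd2' j hj1 hj2
    have hq2 := hdj j (by omega)
    have hh2 : h ^ 2 ≤ h := by nlinarith
    have hscale : A * (2 + 3 / ks) * h ^ k = (2 * A + 3 * (A / ks)) * h ^ k := by ring
    have hterm : |h ^ 2 * (h ^ k * d j / ks)| ≤ A / ks * (h ^ k * h ^ 2) := by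
      rw [abs_mul, abs_div, abs_of_pos hks, abs_of_pos (pow_pos h0 2)]
      calc h ^ 2 * (|h ^ k * d j| / ks) ≤ h ^ 2 * (A * h ^ k / ks) := by gcongr
        _ = _ := by ring
    have hq' : |1 / 2 * (h ^ k * (d (j + 1) + d (j - 1) - 2 * d j)) / ks|
        ≤ A / ks * (h ^ k * h ^ 2) := by
      rw [abs_div, abs_of_pos hks]
      calc _ ≤ A * (h ^ k * h ^ 2) / ks := by gcongr
        _ = _ := by ring
    have hnn : 0 ≤ A * (h ^ k * h ^ 2) := by positivity
    have hnn' : 0 ≤ A / ks * (h ^ k * h ^ 2) := by positivity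
    have hcmp : A * (h ^ k * h ^ 2) ≤ A * (h ^ k * h) := by gcongr
    have hcmp' : A / ks * (h ^ k * h ^ 2) ≤ A / ks * (h ^ k * h) := by gcongr
    unfold residualScale
    rw [hscale]
    have hHk : mesh M = h := rfl
    rw [hHk]
    set q := 1 / 2 * (h ^ k * (d (j + 1) + d (j - 1) - 2 * d j)) with hqdef
    rcases lt_trichotomy i M with hlt | hlt | hgt
    · have hw0 : Lh km ks M w i j = 0 := by
        unfold Lh
        rw [hwL _ _ (by omega), hwL _ _ (by omega), hwL _ _ (by omega), hwL _ _ (by omega),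
          hwL _ _ (by omega)]
        ring
      have := hI i j ⟨hij, by simp only [SB, mem_ofPred_eq]; omega⟩
      rw [if_neg (by omega), hw0, sub_zero]
      rw [hp2] at this
      linarith
    · have hw0 : Lh km ks M w i j = -(h ^ k * d j) - q := by
        unfold Lh
        rw [hwL _ _ (by omega), hwL _ _ (by omega), hwL _ _ (by omega), hwR _ _ (by omega),
          hwR _ _ (by omega), hlt, hkM1, hqdef]
        field_simp
        ring
      have := hM j hj1 hj2
      rw [if_pos (Or.inl hlt), hw0, hlt]
      rw [hp1] at this
      calc |Lh km ks M v M j - (-(h ^ k * d j) - q)|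
          = |(Lh km ks M v M j + h ^ k * d j) + q| := by congr 1; ring
        _ ≤ _ := abs_add_le _ _
        _ ≤ (2 * A + 3 * (A / ks)) * h ^ k * h := by linarith
    · rcases eq_or_ne i (M + 1) with heq | hne
      · have hw0 : Lh km ks M w i j = h ^ k * d j - q / ks + h ^ 2 * (h ^ k * d j / ks) := by
          unfold Lh
          rw [hwL _ _ (by omega), hwL _ _ (by omega), hwR _ _ (by omega), hwR _ _ (by omega),
            hwR _ _ (by omega), hk1 (i + 1) (by omega), heq, hkM1, hqdef, hHk]
          field_simp
          ring
        have := hM1 j hj1 hj2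
        rw [if_pos (Or.inr heq), hw0, heq]
        rw [hp1] at this
        calc |Lh km ks M v (M + 1) j - (h ^ k * d j - q / ks + h ^ 2 * (h ^ k * d j / ks))|
            = |(Lh km ks M v (M + 1) j - h ^ k * d j) + q / ks - h ^ 2 * (h ^ k * d j / ks)| := by
              congr 1; ring
          _ ≤ |Lh km ks M v (M + 1) j - h ^ k * d j| + |q / ks|
                + |h ^ 2 * (h ^ k * d j / ks)| :=
              (abs_sub _ _).trans (add_le_add_left (abs_add_le _ _) _)
          _ ≤ (2 * A + 3 * (A / ks)) * h ^ k * h := by linarith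
      · have hw0 : Lh km ks M w i j = - (2 * (q / ks)) + h ^ 2 * (h ^ k * d j / ks) := by
          unfold Lh
          rw [hwR _ _ (by omega), hwR _ _ (by omega), hwR _ _ (by omega), hwR _ _ (by omega),
            hwR _ _ (by omega), hk1 i (by omega), hk1 (i + 1) (by omega), hqdef, hHk]
          field_simp
          ring
        have := hI i j ⟨hij, by simp only [SB, mem_ofPred_eq]; omega⟩
        rw [if_neg (by omega), hw0]
        rw [hp2] at this
        calc |Lh km ks M v i j - (- (2 * (q / ks)) + h ^ 2 * (h ^ k * d j / ks))|
            = |Lh km ks M v i j + (q / ks + q / ks) - h ^ 2 * (h ^ k * d j / ks)| := by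
              congr 1; ring
          _ ≤ |Lh km ks M v i j| + (|q / ks| + |q / ks|) + |h ^ 2 * (h ^ k * d j / ks)| :=
              (abs_sub _ _).trans (add_le_add_left ((abs_add_le _ _).trans
                (add_le_add_right (abs_add_le _ _) _)) _)
          _ ≤ (2 * A + 3 * (A / ks)) * h ^ k * h ^ 2 := by linarith

/-! ### Directional derivatives and Taylor expansion on a compact convex set -/

lemma exists_abs_le {E : Type*} [TopologicalSpace E] {K : Set E}
    (hKc : IsCompact K) {w : E → ℝ} (hw : ContinuousOn w K) :
    ∃ C, 0 ≤ C ∧ ∀ p ∈ K, |w p| ≤ C := by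
  obtain ⟨C, hC⟩ := hKc.exists_bound_of_continuousOn hw
  exact ⟨max C 0, le_max_right _ _, fun p hp => (hC p hp).trans (le_max_left _ _)⟩

section Calculus

variable {E : Type*} [NormedAddCommGroup E] [NormedSpace ℝ E] {K : Set E}

/-- The derivative of `w` within `K` in the direction `v`. On a closed rectangle it is one-sided
at the boundary, and jointly continuous up to the boundary for `C¹` functions. -/
noncomputable def dirDeriv (K : Set E) (v : E) (w : E → ℝ) (p : E) : ℝ := fderivWithin ℝ w K p v

lemma contDiffOn_dirDeriv (hK : UniqueDiffOn ℝ K) {n : ℕ} {w : E → ℝ}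
    (hw : ContDiffOn ℝ (n + 1 : ℕ) w K) (v : E) : ContDiffOn ℝ n (dirDeriv K v w) K :=
  (hw.fderivWithin hK (by norm_cast)).clm_apply contDiffOn_const

lemma dirDeriv_add_smul {w : E → ℝ} (v v' : E) (s : ℝ) :
    dirDeriv K (s • v + v') w = fun p => s * dirDeriv K v w p + dirDeriv K v' w p := by
  funext p
  simp [dirDeriv]

lemma dirDeriv_mul_add (hK : UniqueDiffOn ℝ K) {f g : E → ℝ} {p : E} (hp : p ∈ K)
    (hf : DifferentiableWithinAt ℝ f K p) (hg : DifferentiableWithinAt ℝ g K p) (v : E) (s : ℝ) :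
    dirDeriv K v (fun q => s * f q + g q) p = s * dirDeriv K v f p + dirDeriv K v g p := by
  unfold dirDeriv
  rw [fderivWithin_fun_add (hK p hp) (hf.const_mul s) hg, fderivWithin_const_mul (hK p hp) hf]
  simp

/-- The second derivatives in two directions that are mirror images of each other: the mixed
derivatives cancel in the sum. -/
lemma dirDeriv_sq_add_dirDeriv_sq (hK : UniqueDiffOn ℝ K) {w : E → ℝ} (hw : ContDiffOn ℝ 2 w K)
    {p : E} (hp : p ∈ K) (v v' : E) (s : ℝ) :
    dirDeriv K (s • v + v') (dirDeriv K (s • v + v') w) p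
      + dirDeriv K (s • v + -v') (dirDeriv K (s • v + -v') w) p
      = 2 * s ^ 2 * dirDeriv K v (dirDeriv K v w) p + 2 * dirDeriv K v' (dirDeriv K v' w) p := by
  have hd : ∀ v, DifferentiableWithinAt ℝ (dirDeriv K v w) K p := fun v =>
    ((contDiffOn_dirDeriv hK (n := 1) (by exact_mod_cast hw) v).differentiableOn (by simp)) p hp
  have hneg : ∀ f : E → ℝ, dirDeriv K (-v') f = fun q => (-1) * dirDeriv K v' f q := by
    intro f; funext q; simp [dirDeriv]
  have hd' : DifferentiableWithinAt ℝ (dirDeriv K (-v') w) K p := hd _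
  simp only [dirDeriv_add_smul]
  rw [dirDeriv_mul_add hK hp (hd v) (hd v'), dirDeriv_mul_add hK hp (hd v) (hd v'),
    dirDeriv_mul_add hK hp (hd v) hd', dirDeriv_mul_add hK hp (hd v) hd']
  have h1 : ∀ u, dirDeriv K u (dirDeriv K (-v') w) p = -dirDeriv K u (dirDeriv K v' w) p := by
    intro u
    rw [hneg]
    have := dirDeriv_mul_add hK hp (hd v') (differentiableWithinAt_const (0 : ℝ)) u (-1)
    simp only [add_zero] at this
    rw [this]
    simp [dirDeriv]
  rw [h1, h1, hneg, hneg]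
  ring

lemma hasDerivWithinAt_line {w : E → ℝ} (hw : DifferentiableOn ℝ w K) {p v : E} {T : Set ℝ}
    (hT : ∀ t ∈ T, p + t • v ∈ K) {t : ℝ} (ht : t ∈ T) :
    HasDerivWithinAt (fun t => w (p + t • v)) (dirDeriv K v w (p + t • v)) T t := by
  have h1 : HasDerivWithinAt (fun t : ℝ => p + t • v) v T t := by
    simpa using ((hasDerivAt_id t).smul_const v).const_add p |>.hasDerivWithinAt
  exact (hw _ (hT t ht)).hasFDerivWithinAt.comp_hasDerivWithinAt t h1 hT

/-- The integration step in the proof of Taylor's formula. -/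
lemma abs_le_mul_abs_pow_succ {f f' : ℝ → ℝ} {C T : ℝ} {n : ℕ} (hC : 0 ≤ C)
    (hf : ∀ t ∈ uIcc 0 T, HasDerivWithinAt f (f' t) (uIcc 0 T) t) (h0 : f 0 = 0)
    (hb : ∀ t ∈ uIcc 0 T, |f' t| ≤ C * |t| ^ n) : |f T| ≤ C * |T| ^ (n + 1) := by
  have hle : ∀ t ∈ uIcc 0 T, |t| ≤ |T| := fun t ht => by
    simpa using abs_sub_left_of_mem_uIcc ht
  have := (convex_uIcc (0 : ℝ) T).norm_image_sub_le_of_norm_hasDerivWithin_le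
    (C := C * |T| ^ n) hf (fun t ht => (hb t ht).trans
      (mul_le_mul_of_nonneg_left (pow_le_pow_left₀ (abs_nonneg _) (hle t ht) n) hC))
    left_mem_uIcc right_mem_uIcc
  rw [h0, sub_zero, sub_zero, Real.norm_eq_abs, Real.norm_eq_abs] at this
  rw [pow_succ, ← mul_assoc]
  exact this

/-- Taylor's formula along segments in a compact convex set, with a remainder that is uniform in
the base point. -/
lemma exists_taylor_bound (hKc : IsCompact K) (hKv : Convex ℝ K) (hK : UniqueDiffOn ℝ K) (v : E)
    (n : ℕ) : ∀ w : E → ℝ, ContDiffOn ℝ n w K → ∃ C, 0 ≤ C ∧ ∀ p ∈ K, ∀ t : ℝ, p + t • v ∈ K →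
      |w (p + t • v) - ∑ k ∈ Finset.range n, t ^ k / k.factorial * ((dirDeriv K v)^[k] w) p|
        ≤ C * |t| ^ n := by
  induction n with
  | zero =>
    intro w hw
    obtain ⟨C, hC⟩ := hKc.exists_bound_of_continuousOn hw.continuousOn
    refine ⟨max C 0, le_max_right _ _, fun p _ t ht => ?_⟩
    simpa only [Finset.sum_range_zero, sub_zero, pow_zero, mul_one, Real.norm_eq_abs] using
      (hC _ ht).trans (le_max_left C 0)
  | succ n ih =>
    intro w hw
    obtain ⟨C, hC0, hC⟩ := ih (dirDeriv K v w) (contDiffOn_dirDeriv hK hw v)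
    refine ⟨C, hC0, fun p hp T hT => ?_⟩
    have hseg : ∀ t ∈ uIcc 0 T, p + t • v ∈ K := by
      intro t ht
      have hc : Convex ℝ ((fun t : ℝ => p + t • v) ⁻¹' K) := by
        have : (fun t : ℝ => p + t • v) = AffineMap.lineMap p (p + v) := by
          funext t; simp [AffineMap.lineMap_apply, add_comm]
        rw [this]
        exact hKv.affine_preimage _
      rw [← segment_eq_uIcc] at ht
      exact hc.segment_subset (by simpa using hp) hT ht
    have hpoly : ∀ t : ℝ, HasDerivAt (fun t : ℝ => ∑ k ∈ Finset.range (n + 1),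
        t ^ k / k.factorial * ((dirDeriv K v)^[k] w) p)
        (∑ k ∈ Finset.range n,
          t ^ k / k.factorial * ((dirDeriv K v)^[k] (dirDeriv K v w)) p) t := by
      intro t
      simp only [Finset.sum_range_succ' _ n, pow_zero]
      refine (HasDerivAt.fun_sum fun k _ => ?_).add_const _
      have h1 := (((hasDerivAt_pow (k + 1) t).div_const ((k + 1).factorial : ℝ)).mul_const
        (((dirDeriv K v)^[k + 1] w) p))
      refine h1.congr_deriv ?_
      rw [Function.iterate_succ_apply, Nat.factorial_succ]
      push_cast
      have : ((k : ℝ) + 1) ≠ 0 := by positivity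
      have : (k.factorial : ℝ) ≠ 0 := by positivity
      field_simp
    refine abs_le_mul_abs_pow_succ (f := fun T => w (p + T • v) - ∑ k ∈ Finset.range (n + 1),
        T ^ k / k.factorial * ((dirDeriv K v)^[k] w) p) hC0
      (fun t ht => (hasDerivWithinAt_line (hw.differentiableOn (by simp)) hseg ht).sub
        (hpoly t).hasDerivWithinAt) ?_ (fun t ht => hC p hp t (hseg t ht))
    simp [Finset.sum_range_succ']

lemma exists_abs_sub_le (hKc : IsCompact K) (hKv : Convex ℝ K) (hK : UniqueDiffOn ℝ K) (v : E)
    {w : E → ℝ} (hw : ContDiffOn ℝ 1 w K) : ∃ C, 0 ≤ C ∧ ∀ p ∈ K, ∀ t : ℝ, p + t • v ∈ K →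
      |w (p + t • v) - w p| ≤ C * |t| := by
  simpa using exists_taylor_bound hKc hKv hK v 1 w (by exact_mod_cast hw)

lemma exists_taylor_three (hKc : IsCompact K) (hKv : Convex ℝ K) (hK : UniqueDiffOn ℝ K) (v : E)
    {w : E → ℝ} (hw : ContDiffOn ℝ 3 w K) : ∃ C, 0 ≤ C ∧ ∀ p ∈ K, ∀ t : ℝ, p + t • v ∈ K →
      |w (p + t • v) - (w p + t * dirDeriv K v w p
        + t ^ 2 / 2 * dirDeriv K v (dirDeriv K v w) p)| ≤ C * |t| ^ 3 := by
  simpa [Finset.sum_range_succ] using exists_taylor_bound hKc hKv hK v 3 w (by exact_mod_cast hw)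

/-- The symmetric second difference: the odd terms of Taylor's formula cancel. -/
lemma exists_second_difference_bound (hKc : IsCompact K) (hKv : Convex ℝ K)
    (hK : UniqueDiffOn ℝ K) (v : E) {w : E → ℝ} (hw : ContDiffOn ℝ 4 w K) :
    ∃ C, 0 ≤ C ∧ ∀ p ∈ K, ∀ t : ℝ, p + t • v ∈ K → p + (-t) • v ∈ K →
      |w (p + t • v) + w (p + (-t) • v) - 2 * w p - t ^ 2 * dirDeriv K v (dirDeriv K v w) p|
        ≤ C * t ^ 4 := by
  obtain ⟨C, hC0, hC⟩ := exists_taylor_bound hKc hKv hK v 4 w (by exact_mod_cast hw)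
  refine ⟨2 * C, by positivity, fun p hp t h1 h2 => ?_⟩
  have e1 := hC p hp t h1
  have e2 := hC p hp (-t) h2
  simp only [Finset.sum_range_succ, Finset.sum_range_zero, Nat.factorial, abs_neg,
    Function.iterate_succ_apply, Function.iterate_zero, id] at e1 e2
  rw [Even.pow_abs ⟨2, rfl⟩] at e1 e2
  rw [abs_le] at *
  constructor <;> ring_nf at * <;> linarith

/-- The average of `w` over two points that are mirror images of each other in the direction `v'`,
at a signed distance `s * t` in the direction `v`. -/
lemma exists_mirror_average_bound (hKc : IsCompact K) (hKv : Convex ℝ K) (hK : UniqueDiffOn ℝ K)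
    (v v' : E) (s : ℝ) {w : E → ℝ} (hw : ContDiffOn ℝ 3 w K) :
    ∃ C, 0 ≤ C ∧ ∀ p ∈ K, ∀ t : ℝ, 0 ≤ t → p + t • (s • v + v') ∈ K →
      p + t • (s • v + -v') ∈ K →
      |1 / 2 * (w (p + t • (s • v + v')) + w (p + t • (s • v + -v'))) - (w p
        + s * t * dirDeriv K v w p + (s * t) ^ 2 / 2 * dirDeriv K v (dirDeriv K v w) p
        + t ^ 2 / 2 * dirDeriv K v' (dirDeriv K v' w) p)| ≤ C * t ^ 3 := by
  obtain ⟨C₁, hC₁, h₁⟩ := exists_taylor_three hKc hKv hK (s • v + v') hw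
  obtain ⟨C₂, hC₂, h₂⟩ := exists_taylor_three hKc hKv hK (s • v + -v') hw
  refine ⟨C₁ + C₂, by positivity, fun p hp t ht hp1 hp2 => ?_⟩
  have e1 := h₁ p hp t hp1
  have e2 := h₂ p hp t hp2
  have hsq := dirDeriv_sq_add_dirDeriv_sq hK (hw.of_le (by norm_num)) hp v v' s
  have d1 : dirDeriv K (s • v + v') w p = s * dirDeriv K v w p + dirDeriv K v' w p := by
    rw [dirDeriv_add_smul]
  have d2 : dirDeriv K (s • v + -v') w p = s * dirDeriv K v w p - dirDeriv K v' w p := by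
    rw [dirDeriv_add_smul]; simp [dirDeriv]; ring
  rw [d1] at e1
  rw [d2] at e2
  rw [abs_of_nonneg ht] at e1 e2
  set X := dirDeriv K (s • v + v') (dirDeriv K (s • v + v') w) p
  set Y := dirDeriv K (s • v + -v') (dirDeriv K (s • v + -v') w) p
  have hX : X = 2 * s ^ 2 * dirDeriv K v (dirDeriv K v w) p
    + 2 * dirDeriv K v' (dirDeriv K v' w) p - Y := by linarith
  rw [hX] at e1
  have ht3 : 0 ≤ C₁ * t ^ 3 := by positivity
  have ht4 : 0 ≤ C₂ * t ^ 3 := by positivity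
  rw [abs_le] at *
  constructor <;> ring_nf at * <;> linarith

end Calculus

/-! ### Partial derivatives on the closed subdomains -/

/-- The closed rectangle `[α, β] × [0, 1]`. -/
def rect (α β : ℝ) : Set (ℝ × ℝ) := Icc α β ×ˢ Icc (0 : ℝ) 1

lemma closure_D1 : closure D1 = rect 0 (1 / 2) := by
  rw [D1, closure_prod_eq, closure_Ioo (by norm_num), closure_Ioo (by norm_num), rect]

lemma closure_D2 : closure D2 = rect (1 / 2) 1 := by
  rw [D2, closure_prod_eq, closure_Ioo (by norm_num), closure_Ioo (by norm_num), rect]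

lemma isCompact_rect (α β : ℝ) : IsCompact (rect α β) := isCompact_Icc.prod isCompact_Icc

lemma convex_rect (α β : ℝ) : Convex ℝ (rect α β) := (convex_Icc _ _).prod (convex_Icc _ _)

lemma uniqueDiffOn_rect {α β : ℝ} (h : α < β) : UniqueDiffOn ℝ (rect α β) :=
  (uniqueDiffOn_Icc h).prod (uniqueDiffOn_Icc one_pos)

lemma mem_rect {α β x y : ℝ} :
    (x, y) ∈ rect α β ↔ (α ≤ x ∧ x ≤ β) ∧ (0 ≤ y ∧ y ≤ 1) := Iff.rfl

/-- The partial derivative in `x` within the set `K`. -/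
noncomputable abbrev partialX (K : Set (ℝ × ℝ)) (w : ℝ × ℝ → ℝ) : ℝ × ℝ → ℝ :=
  dirDeriv K ((1 : ℝ), (0 : ℝ)) w

/-- The partial derivative in `y` within the set `K`. -/
noncomputable abbrev partialY (K : Set (ℝ × ℝ)) (w : ℝ × ℝ → ℝ) : ℝ × ℝ → ℝ :=
  dirDeriv K ((0 : ℝ), (1 : ℝ)) w

lemma rect_mem_nhds {α β x y : ℝ} (hx : x ∈ Ioo α β) (hy : y ∈ Ioo (0 : ℝ) 1) :
    rect α β ∈ 𝓝 (x, y) :=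
  prod_mem_nhds (Icc_mem_nhds hx.1 hx.2) (Icc_mem_nhds hy.1 hy.2)

lemma hasFDerivAt_of_interior {α β x y : ℝ} {g : ℝ × ℝ → ℝ}
    (hg : DifferentiableOn ℝ g (rect α β)) (hx : x ∈ Ioo α β) (hy : y ∈ Ioo (0 : ℝ) 1) :
    HasFDerivAt g (fderivWithin ℝ g (rect α β) (x, y)) (x, y) :=
  (hg _ (mem_of_mem_nhds (rect_mem_nhds hx hy))).hasFDerivWithinAt.hasFDerivAt
    (rect_mem_nhds hx hy)

lemma deriv_fst_eq_partialX {α β x y : ℝ} {g : ℝ × ℝ → ℝ}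
    (hg : DifferentiableOn ℝ g (rect α β)) (hx : x ∈ Ioo α β) (hy : y ∈ Ioo (0 : ℝ) 1) :
    deriv (fun s => g (s, y)) x = partialX (rect α β) g (x, y) :=
  ((hasFDerivAt_of_interior hg hx hy).comp_hasDerivAt x
    ((hasDerivAt_id x).prodMk (hasDerivAt_const x y))).deriv

lemma deriv_snd_eq_partialY {α β x y : ℝ} {g : ℝ × ℝ → ℝ}
    (hg : DifferentiableOn ℝ g (rect α β)) (hx : x ∈ Ioo α β) (hy : y ∈ Ioo (0 : ℝ) 1) :
    deriv (fun t => g (x, t)) y = partialY (rect α β) g (x, y) :=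
  ((hasFDerivAt_of_interior hg hx hy).comp_hasDerivAt y
    ((hasDerivAt_const y x).prodMk (hasDerivAt_id y))).deriv

lemma dy_dy_eq_partialY {α β x y : ℝ} {u : ℝ → ℝ → ℝ} (hαβ : α < β)
    (hu : ContDiffOn ℝ 6 (fun p : ℝ × ℝ => u p.1 p.2) (rect α β))
    (hx : x ∈ Ioo α β) (hy : y ∈ Ioo (0 : ℝ) 1) :
    dy (dy u) x y = partialY (rect α β) (partialY (rect α β) fun p => u p.1 p.2) (x, y) := by
  have h1 := contDiffOn_dirDeriv (uniqueDiffOn_rect hαβ) (n := 5) (by exact_mod_cast hu)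
    ((0 : ℝ), (1 : ℝ))
  rw [← deriv_snd_eq_partialY (h1.differentiableOn (by simp)) hx hy, dy]
  refine Filter.EventuallyEq.deriv_eq ?_
  filter_upwards [Ioo_mem_nhds hy.1 hy.2] with t ht
  exact deriv_snd_eq_partialY (hu.differentiableOn (by simp)) hx ht

lemma dx_eq_partialX {α β x y : ℝ} {u : ℝ → ℝ → ℝ}
    (hu : ContDiffOn ℝ 6 (fun p : ℝ × ℝ => u p.1 p.2) (rect α β))
    (hx : x ∈ Ioo α β) (hy : y ∈ Ioo (0 : ℝ) 1) :
    dx u x y = partialX (rect α β) (fun p => u p.1 p.2) (x, y) :=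
  deriv_fst_eq_partialX (hu.differentiableOn (by simp)) hx hy

lemma diffusionOp_eq {α β x y c km : ℝ} {u : ℝ → ℝ → ℝ} (hαβ : α < β)
    (hu : ContDiffOn ℝ 6 (fun p : ℝ × ℝ => u p.1 p.2) (rect α β))
    (hc : ∀ s ∈ Ioo α β, ∀ t, coeff km s t = c) (hx : x ∈ Ioo α β) (hy : y ∈ Ioo (0 : ℝ) 1) :
    diffusionOp km u x y =
      -(c * (partialX (rect α β) (partialX (rect α β) fun p => u p.1 p.2) (x, y)
        + partialY (rect α β) (partialY (rect α β) fun p => u p.1 p.2) (x, y))) + u x y := by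
  have h1 := contDiffOn_dirDeriv (uniqueDiffOn_rect hαβ) (n := 5) (by exact_mod_cast hu)
    ((1 : ℝ), (0 : ℝ))
  have e1 : dx (fun s t => coeff km s t * dx u s t) x y
      = c * partialX (rect α β) (partialX (rect α β) fun p => u p.1 p.2) (x, y) := by
    rw [← deriv_fst_eq_partialX (h1.differentiableOn (by simp)) hx hy, dx, ← deriv_const_mul_field]
    refine Filter.EventuallyEq.deriv_eq ?_
    filter_upwards [Ioo_mem_nhds hx.1 hx.2] with s hs
    rw [hc s hs, dx_eq_partialX hu hs hy]
  have e2 : dy (fun s t => coeff km s t * dy u s t) x y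
      = c * partialY (rect α β) (partialY (rect α β) fun p => u p.1 p.2) (x, y) := by
    rw [← dy_dy_eq_partialY hαβ hu hx hy]
    simp only [dy, hc x hx]
    rw [deriv_const_mul_field]
  rw [diffusionOp, e1, e2]
  ring

lemma tendsto_left {α y : ℝ} (hα : α < 1 / 2) {g : ℝ × ℝ → ℝ}
    (hg : ContinuousOn g (rect α (1 / 2))) (hy : y ∈ Ioo (0 : ℝ) 1) :
    Tendsto (fun x => g (x, y)) (𝓝[<] (1 / 2)) (𝓝 (g (1 / 2, y))) := by
  have h1 : ContinuousOn (fun x => g (x, y)) (Icc α (1 / 2)) :=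
    hg.comp (by fun_prop) fun x hx => ⟨hx, hy.1.le, hy.2.le⟩
  rw [← nhdsWithin_Ioo_eq_nhdsLT hα]
  exact (h1 _ (right_mem_Icc.2 hα.le)).mono Ioo_subset_Icc_self

lemma tendsto_right {β y : ℝ} (hβ : 1 / 2 < β) {g : ℝ × ℝ → ℝ}
    (hg : ContinuousOn g (rect (1 / 2) β)) (hy : y ∈ Ioo (0 : ℝ) 1) :
    Tendsto (fun x => g (x, y)) (𝓝[>] (1 / 2)) (𝓝 (g (1 / 2, y))) := by
  have h1 : ContinuousOn (fun x => g (x, y)) (Icc (1 / 2) β) :=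
    hg.comp (by fun_prop) fun x hx => ⟨hx, hy.1.le, hy.2.le⟩
  rw [← nhdsWithin_Ioo_eq_nhdsGT hβ]
  exact (h1 _ (left_mem_Icc.2 hβ.le)).mono Ioo_subset_Icc_self

/-- Continuity of the flux, expressed by the one-sided derivatives at the interface. -/
lemma flux_eq {km y : ℝ} {u : ℝ → ℝ → ℝ}
    (h1 : ContDiffOn ℝ 6 (fun p : ℝ × ℝ => u p.1 p.2) (rect 0 (1 / 2)))
    (h2 : ContDiffOn ℝ 6 (fun p : ℝ × ℝ => u p.1 p.2) (rect (1 / 2) 1))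
    (hj : NoJump fun x y => coeff km x y * dx u x y) (hy : y ∈ Ioo (0 : ℝ) 1) :
    partialX (rect (1 / 2) 1) (fun p => u p.1 p.2) (1 / 2, y)
      = km * partialX (rect 0 (1 / 2)) (fun p => u p.1 p.2) (1 / 2, y) := by
  obtain ⟨l, hl1, hl2⟩ := hj y hy
  have hU1 := uniqueDiffOn_rect (show (0 : ℝ) < 1 / 2 by norm_num)
  have hU2 := uniqueDiffOn_rect (show (1 / 2 : ℝ) < 1 by norm_num)
  have c1 := (contDiffOn_dirDeriv hU1 (n := 5) (by exact_mod_cast h1)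
    ((1 : ℝ), (0 : ℝ))).continuousOn
  have c2 := (contDiffOn_dirDeriv hU2 (n := 5) (by exact_mod_cast h2)
    ((1 : ℝ), (0 : ℝ))).continuousOn
  have t1 := (tendsto_left (by norm_num) c1 hy).const_mul km
  have t2 := tendsto_right (by norm_num) c2 hy
  have e1 := tendsto_nhds_unique hl1 (t1.congr' ?_)
  · have e2 := tendsto_nhds_unique hl2 (t2.congr' ?_)
    · exact e2.symm.trans e1
    · filter_upwards [Ioo_mem_nhdsGT (show (1 / 2 : ℝ) < 1 by norm_num)] with x hx
      rw [dx_eq_partialX h2 hx hy, coeff, if_neg (by linarith [hx.1]), one_mul]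
  · filter_upwards [Ioo_mem_nhdsLT (show (0 : ℝ) < 1 / 2 by norm_num)] with x hx
    rw [dx_eq_partialX h1 hx hy, coeff, if_pos hx.2]

/-- Under Assumption I the second tangential derivatives vanish on the interface, from either
side. -/
lemma partialY_partialY_eq_zero {km ks y : ℝ} {u : ℝ → ℝ → ℝ}
    (h1 : ContDiffOn ℝ 6 (fun p : ℝ × ℝ => u p.1 p.2) (rect 0 (1 / 2)))
    (h2 : ContDiffOn ℝ 6 (fun p : ℝ × ℝ => u p.1 p.2) (rect (1 / 2) 1))
    (hA : AssumptionI km ks u) (hy : y ∈ Ioo (0 : ℝ) 1) :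
    partialY (rect 0 (1 / 2)) (partialY (rect 0 (1 / 2)) fun p => u p.1 p.2) (1 / 2, y) = 0 ∧
    partialY (rect (1 / 2) 1) (partialY (rect (1 / 2) 1) fun p => u p.1 p.2) (1 / 2, y) = 0 := by
  obtain ⟨hl1, hl2⟩ := hA.2 y hy
  have hU1 := uniqueDiffOn_rect (show (0 : ℝ) < 1 / 2 by norm_num)
  have hU2 := uniqueDiffOn_rect (show (1 / 2 : ℝ) < 1 by norm_num)
  have c1 := (contDiffOn_dirDeriv hU1 (n := 4) (contDiffOn_dirDeriv hU1 (n := 5)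
    (by exact_mod_cast h1) ((0 : ℝ), (1 : ℝ))) ((0 : ℝ), (1 : ℝ))).continuousOn
  have c2 := (contDiffOn_dirDeriv hU2 (n := 4) (contDiffOn_dirDeriv hU2 (n := 5)
    (by exact_mod_cast h2) ((0 : ℝ), (1 : ℝ))) ((0 : ℝ), (1 : ℝ))).continuousOn
  constructor
  · refine tendsto_nhds_unique ((tendsto_left (by norm_num) c1 hy).congr' ?_) hl1
    filter_upwards [Ioo_mem_nhdsLT (show (0 : ℝ) < 1 / 2 by norm_num)] with x hx
    rw [dy_dy_eq_partialY (by norm_num) h1 hx hy]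
  · refine tendsto_nhds_unique ((tendsto_right (by norm_num) c2 hy).congr' ?_) hl2
    filter_upwards [Ioo_mem_nhdsGT (show (1 / 2 : ℝ) < 1 by norm_num)] with x hx
    rw [dy_dy_eq_partialY (by norm_num) h2 hx hy]

/-! ### Truncation error away from the interface -/

lemma cast_pred_mul {i : ℕ} (hi : 1 ≤ i) (h : ℝ) : ((i - 1 : ℕ) : ℝ) * h = i * h - h := by
  rw [Nat.cast_sub hi, Nat.cast_one]; ring

lemma cast_succ_mul (i : ℕ) (h : ℝ) : ((i + 1 : ℕ) : ℝ) * h = i * h + h := by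
  push_cast; ring

lemma node_mem {M j : ℕ} (h1 : 1 ≤ j) (h2 : j ≤ 2 * M) :
    mesh M ≤ j * mesh M ∧ j * mesh M ≤ 1 - mesh M := by
  have h0 := mesh_pos M
  have hc := cells_mul_mesh M
  have h1' : (1 : ℝ) ≤ j := by exact_mod_cast h1
  have h2' : (j : ℝ) ≤ 2 * M := by exact_mod_cast h2
  constructor <;> nlinarith

/-- The diagonal five-point difference quotient approximates the Laplacian. -/
lemma exists_diagonal_laplacian_bound {α β : ℝ} (hαβ : α < β) {w : ℝ × ℝ → ℝ}
    (hw : ContDiffOn ℝ 4 w (rect α β)) :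
    ∃ C, 0 ≤ C ∧ ∀ x y h : ℝ, 0 ≤ h → α ≤ x - h → x + h ≤ β → 0 ≤ y - h → y + h ≤ 1 →
      |w (x - h, y - h) + w (x - h, y + h) + w (x + h, y - h) + w (x + h, y + h) - 4 * w (x, y)
        - 2 * h ^ 2 * (partialX (rect α β) (partialX (rect α β) w) (x, y)
          + partialY (rect α β) (partialY (rect α β) w) (x, y))| ≤ C * h ^ 4 := by
  have hU := uniqueDiffOn_rect hαβ
  have hC := isCompact_rect α β
  have hV := convex_rect α β
  obtain ⟨C₁, hC₁, h₁⟩ := exists_second_difference_bound hC hV hU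
    ((1 : ℝ) • ((1 : ℝ), (0 : ℝ)) + ((0 : ℝ), (1 : ℝ))) hw
  obtain ⟨C₂, hC₂, h₂⟩ := exists_second_difference_bound hC hV hU
    ((1 : ℝ) • ((1 : ℝ), (0 : ℝ)) + -((0 : ℝ), (1 : ℝ))) hw
  refine ⟨C₁ + C₂, by positivity, fun x y h h0 hx1 hx2 hy1 hy2 => ?_⟩
  have hp : (x, y) ∈ rect α β := mem_rect.2 ⟨⟨by linarith, by linarith⟩, by linarith, by linarith⟩
  have p1 : (x, y) + h • ((1 : ℝ) • ((1 : ℝ), (0 : ℝ)) + ((0 : ℝ), (1 : ℝ))) = (x + h, y + h) := by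
    simp
  have p2 : (x, y) + (-h) • ((1 : ℝ) • ((1 : ℝ), (0 : ℝ)) + ((0 : ℝ), (1 : ℝ)))
      = (x - h, y - h) := by simp [sub_eq_add_neg]
  have p3 : (x, y) + h • ((1 : ℝ) • ((1 : ℝ), (0 : ℝ)) + -((0 : ℝ), (1 : ℝ)))
      = (x + h, y - h) := by simp [sub_eq_add_neg]
  have p4 : (x, y) + (-h) • ((1 : ℝ) • ((1 : ℝ), (0 : ℝ)) + -((0 : ℝ), (1 : ℝ)))
      = (x - h, y + h) := by simp [sub_eq_add_neg]
  have e1 := h₁ (x, y) hp h (by rw [p1, mem_rect]; refine ⟨⟨?_, ?_⟩, ?_, ?_⟩ <;> linarith)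
    (by rw [p2, mem_rect]; refine ⟨⟨?_, ?_⟩, ?_, ?_⟩ <;> linarith)
  have e2 := h₂ (x, y) hp h (by rw [p3, mem_rect]; refine ⟨⟨?_, ?_⟩, ?_, ?_⟩ <;> linarith)
    (by rw [p4, mem_rect]; refine ⟨⟨?_, ?_⟩, ?_, ?_⟩ <;> linarith)
  rw [p1, p2] at e1
  rw [p3, p4] at e2
  have hsq := dirDeriv_sq_add_dirDeriv_sq hU (hw.of_le (by norm_num)) hp
    ((1 : ℝ), (0 : ℝ)) ((0 : ℝ), (1 : ℝ)) 1
  set X := dirDeriv (rect α β) ((1 : ℝ) • ((1 : ℝ), (0 : ℝ)) + ((0 : ℝ), (1 : ℝ)))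
    (dirDeriv (rect α β) ((1 : ℝ) • ((1 : ℝ), (0 : ℝ)) + ((0 : ℝ), (1 : ℝ))) w) (x, y)
  set Y := dirDeriv (rect α β) ((1 : ℝ) • ((1 : ℝ), (0 : ℝ)) + -((0 : ℝ), (1 : ℝ)))
    (dirDeriv (rect α β) ((1 : ℝ) • ((1 : ℝ), (0 : ℝ)) + -((0 : ℝ), (1 : ℝ))) w) (x, y)
  calc _ = |(w (x + h, y + h) + w (x - h, y - h) - 2 * w (x, y) - h ^ 2 * X)
        + (w (x + h, y - h) + w (x - h, y + h) - 2 * w (x, y) - h ^ 2 * Y)| := by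
        congr 1
        linear_combination h ^ 2 * hsq
    _ ≤ _ := abs_add_le _ _
    _ ≤ C₁ * h ^ 4 + C₂ * h ^ 4 := add_le_add e1 e2
    _ = _ := by ring

lemma exists_truncError_bound {α β c km ks : ℝ} (hαβ : α < β) {f u : ℝ → ℝ → ℝ}
    (hu : ContDiffOn ℝ 6 (fun p : ℝ × ℝ => u p.1 p.2) (rect α β))
    (hc : ∀ s ∈ Ioo α β, ∀ t, coeff km s t = c)
    (heq : ∀ x ∈ Ioo α β, ∀ y ∈ Ioo (0 : ℝ) 1, diffusionOp km u x y = f x y) :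
    ∃ C, 0 ≤ C ∧ ∀ M i j : ℕ, (i, j) ∈ S0 M → α ≤ i * mesh M - mesh M →
      i * mesh M + mesh M ≤ β → cellCoeff km ks M i = c → cellCoeff km ks M (i + 1) = c →
      |truncError km ks f u M i j| ≤ C * mesh M ^ 4 := by
  obtain ⟨C, hC0, hC⟩ := exists_diagonal_laplacian_bound hαβ (hu.of_le (by norm_num))
  refine ⟨|c| * C, by positivity, fun M i j hij h1 h2 k1 k2 => ?_⟩
  rw [mem_S0] at hij
  have h0 := mesh_pos M
  obtain ⟨hy1, hy2⟩ := node_mem hij.2.1 hij.2.2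
  set h := mesh M with hh
  have hb := hC (i * h) (j * h) h h0.le h1 h2 (by linarith) (by linarith)
  have hf := heq (i * h) ⟨by linarith, by linarith⟩ (j * h) ⟨by linarith, by linarith⟩
  rw [diffusionOp_eq hαβ hu hc ⟨by linarith, by linarith⟩ ⟨by linarith, by linarith⟩] at hf
  simp only [truncError, Lh, nodal, k1, k2, cast_pred_mul hij.1.1, cast_pred_mul hij.2.1,
    cast_succ_mul, ← hh, ← hf]
  simp only at hb
  set X := partialX (rect α β) (partialX (rect α β) fun p => u p.1 p.2) (i * h, j * h)
  set Y := partialY (rect α β) (partialY (rect α β) fun p => u p.1 p.2) (i * h, j * h)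
  have habs : ∀ z : ℝ, |z| ≤ C * h ^ 4 → |-(c / 2) * z| ≤ |c| * C * h ^ 4 := by
    intro z hz
    rw [abs_mul, abs_neg, abs_div, abs_two]
    have hz' := mul_le_mul_of_nonneg_left hz (abs_nonneg c)
    nlinarith [mul_nonneg (abs_nonneg c) (abs_nonneg z)]
  refine le_of_eq_of_le ?_ (habs _ hb)
  congr 1
  ring

/-! ### Truncation error next to the interface -/

/-- Expansions about the interface from one side. The side is encoded by the sign `σ`, and `a`,
`p`, `r` stand for the one-sided derivatives `∂ₓu`, `∂ₓ²u`, `∂ᵧ²u` at the interface. The near column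
is at distance `h/2`, the far column at distance `3h/2`. The first bound is the part of the
truncation error that the far neighbours contribute, the other two expand the values in the near
column and their averages over two neighbours. -/
lemma exists_one_sided_expansion {α β σ c km : ℝ} (hσ : σ = 1 ∨ σ = -1) (hαβ : α < β)
    (hmem : ∀ s : ℝ, 0 ≤ s → s ≤ 1 / 2 → α ≤ 1 / 2 + σ * s ∧ 1 / 2 + σ * s ≤ β)
    (hint : ∀ s : ℝ, 0 < s → s < 1 / 2 → α < 1 / 2 + σ * s ∧ 1 / 2 + σ * s < β)
    {f u : ℝ → ℝ → ℝ} (hu : ContDiffOn ℝ 6 (fun p : ℝ × ℝ => u p.1 p.2) (rect α β))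
    (hc : ∀ s ∈ Ioo α β, ∀ t, coeff km s t = c)
    (heq : ∀ x ∈ Ioo α β, ∀ y ∈ Ioo (0 : ℝ) 1, diffusionOp km u x y = f x y) :
    ∃ C, 0 ≤ C ∧ ∀ y h a p r : ℝ, 0 < h → h ≤ 1 / 3 → h ≤ y → y ≤ 1 - h →
      a = partialX (rect α β) (fun p => u p.1 p.2) (1 / 2, y) →
      p = partialX (rect α β) (partialX (rect α β) fun p => u p.1 p.2) (1 / 2, y) →
      r = partialY (rect α β) (partialY (rect α β) fun p => u p.1 p.2) (1 / 2, y) →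
      |c * (u (1 / 2 + σ * (h / 2)) y - 1 / 2 * (u (1 / 2 + σ * (3 * h / 2)) (y + h)
          + u (1 / 2 + σ * (3 * h / 2)) (y - h)))
        + h ^ 2 * (u (1 / 2 + σ * (h / 2)) y - f (1 / 2 + σ * (h / 2)) y)
        - c * (-(σ * h * a) + h ^ 2 * r / 2)| ≤ C * h ^ 3 ∧
      |u (1 / 2 + σ * (h / 2)) y - (u (1 / 2) y + σ * h / 2 * a + h ^ 2 / 8 * p)| ≤ C * h ^ 3 ∧
      |1 / 2 * (u (1 / 2 + σ * (h / 2)) (y + h) + u (1 / 2 + σ * (h / 2)) (y - h))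
        - (u (1 / 2) y + σ * h / 2 * a + h ^ 2 / 8 * p + h ^ 2 / 2 * r)| ≤ C * h ^ 3 := by
  have hU := uniqueDiffOn_rect hαβ
  have hC := isCompact_rect α β
  have hV := convex_rect α β
  have hσ2 : σ ^ 2 = 1 := by rcases hσ with rfl | rfl <;> norm_num
  have hσa : |σ| = 1 := by rcases hσ with rfl | rfl <;> norm_num
  have hu3 : ContDiffOn ℝ 3 (fun p : ℝ × ℝ => u p.1 p.2) (rect α β) := hu.of_le (by norm_num)
  have hXX : ContDiffOn ℝ 1
      (partialX (rect α β) (partialX (rect α β) fun p => u p.1 p.2)) (rect α β) := by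
    exact_mod_cast contDiffOn_dirDeriv hU (n := 1) (contDiffOn_dirDeriv hU (n := 2)
      (by exact_mod_cast hu3) _) _
  have hYY : ContDiffOn ℝ 1
      (partialY (rect α β) (partialY (rect α β) fun p => u p.1 p.2)) (rect α β) := by
    exact_mod_cast contDiffOn_dirDeriv hU (n := 1) (contDiffOn_dirDeriv hU (n := 2)
      (by exact_mod_cast hu3) _) _
  obtain ⟨C₁, hC₁, h₁⟩ := exists_taylor_three hC hV hU ((1 : ℝ), (0 : ℝ)) hu3
  obtain ⟨C₂, hC₂, h₂⟩ := exists_mirror_average_bound hC hV hU ((1 : ℝ), (0 : ℝ))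
    ((0 : ℝ), (1 : ℝ)) (σ * (1 / 2)) hu3
  obtain ⟨C₃, hC₃, h₃⟩ := exists_mirror_average_bound hC hV hU ((1 : ℝ), (0 : ℝ))
    ((0 : ℝ), (1 : ℝ)) (σ * (3 / 2)) hu3
  obtain ⟨C₄, hC₄, h₄⟩ := exists_abs_sub_le hC hV hU ((1 : ℝ), (0 : ℝ)) hXX
  obtain ⟨C₅, hC₅, h₅⟩ := exists_abs_sub_le hC hV hU ((1 : ℝ), (0 : ℝ)) hYY
  refine ⟨|c| * (C₁ + C₃ + C₄ + C₅) + C₁ + C₂, by positivity, ?_⟩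
  intro y h a p r h0 hh hy1 hy2 ha hp hr
  have m0 : ((1 / 2 : ℝ), y) ∈ rect α β := by
    have := hmem 0 le_rfl (by norm_num)
    rw [mul_zero, add_zero] at this
    exact ⟨this, by constructor <;> simp only <;> linarith⟩
  have m1 : ∀ s : ℝ, 0 ≤ s → s ≤ 1 / 2 → ∀ y', 0 ≤ y' → y' ≤ 1 →
      (1 / 2 + σ * s, y') ∈ rect α β := fun s hs hs' y' h1 h2 => ⟨hmem s hs hs', h1, h2⟩
  have pt0 : ((1 / 2 : ℝ), y) + (σ * (h / 2)) • ((1 : ℝ), (0 : ℝ)) = (1 / 2 + σ * (h / 2), y) := by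
    simp
  have pt1 : ∀ k : ℝ, ((1 / 2 : ℝ), y) + h • ((σ * k) • ((1 : ℝ), (0 : ℝ)) + ((0 : ℝ), (1 : ℝ)))
      = (1 / 2 + σ * (k * h), y + h) := by
    intro k; simp; ring
  have pt2 : ∀ k : ℝ, ((1 / 2 : ℝ), y) + h • ((σ * k) • ((1 : ℝ), (0 : ℝ)) + -((0 : ℝ), (1 : ℝ)))
      = (1 / 2 + σ * (k * h), y - h) := by
    intro k; simp; constructor <;> ring
  have mn : (1 / 2 + σ * (h / 2), y) ∈ rect α β :=
    m1 _ (by linarith) (by linarith) _ (by linarith) (by linarith)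
  have e1 := h₁ _ m0 (σ * (h / 2)) (by rw [pt0]; exact mn)
  have e4 := h₄ _ m0 (σ * (h / 2)) (by rw [pt0]; exact mn)
  have e5 := h₅ _ m0 (σ * (h / 2)) (by rw [pt0]; exact mn)
  have e2 := h₂ _ m0 h h0.le
    (by rw [pt1]; exact m1 _ (by linarith) (by linarith) _ (by linarith) (by linarith))
    (by rw [pt2]; exact m1 _ (by linarith) (by linarith) _ (by linarith) (by linarith))
  have e3 := h₃ _ m0 h h0.le
    (by rw [pt1]; exact m1 _ (by linarith) (by linarith) _ (by linarith) (by linarith))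
    (by rw [pt2]; exact m1 _ (by linarith) (by linarith) _ (by linarith) (by linarith))
  rw [pt0, abs_mul, hσa, one_mul, abs_of_pos (by linarith : 0 < h / 2)] at e1 e4 e5
  rw [pt1, pt2] at e2 e3
  have hxi : 1 / 2 + σ * (h / 2) ∈ Ioo α β := hint _ (by linarith) (by linarith)
  have hyi : y ∈ Ioo (0 : ℝ) 1 := ⟨by linarith, by linarith⟩
  have hf := heq _ hxi y hyi
  rw [diffusionOp_eq hαβ hu hc hxi hyi] at hf
  simp only [partialX, partialY] at e1 e2 e3 e4 e5 hf ha hp hr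
  rw [← ha, ← hp] at e1
  rw [← ha, ← hp, ← hr, show (1 / 2 : ℝ) * h = h / 2 by ring] at e2
  rw [← ha, ← hp, ← hr, show (3 / 2 : ℝ) * h = 3 * h / 2 by ring] at e3
  rw [← hp] at e4
  rw [← hr] at e5
  set X := dirDeriv (rect α β) (1, 0) (dirDeriv (rect α β) (1, 0) fun p => u p.1 p.2)
    (1 / 2 + σ * (h / 2), y)
  set Y := dirDeriv (rect α β) (0, 1) (dirDeriv (rect α β) (0, 1) fun p => u p.1 p.2)
    (1 / 2 + σ * (h / 2), y)
  have hh3 : 0 < h ^ 3 := by positivity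
  have b1 : |u (1 / 2 + σ * (h / 2)) y - (u (1 / 2) y + σ * h / 2 * a + h ^ 2 / 8 * p)|
      ≤ C₁ * h ^ 3 := by
    refine (le_of_eq ?_).trans (e1.trans ?_)
    · congr 1; linear_combination (h ^ 2 / 8 * p) * hσ2
    · gcongr; linarith
  have b2 : |1 / 2 * (u (1 / 2 + σ * (h / 2)) (y + h) + u (1 / 2 + σ * (h / 2)) (y - h))
      - (u (1 / 2) y + σ * h / 2 * a + h ^ 2 / 8 * p + h ^ 2 / 2 * r)| ≤ C₂ * h ^ 3 := by
    refine (le_of_eq ?_).trans e2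
    congr 1; linear_combination (h ^ 2 / 8 * p) * hσ2
  have b3 : |1 / 2 * (u (1 / 2 + σ * (3 * h / 2)) (y + h) + u (1 / 2 + σ * (3 * h / 2)) (y - h))
      - (u (1 / 2) y + 3 * σ * h / 2 * a + 9 * h ^ 2 / 8 * p + h ^ 2 / 2 * r)| ≤ C₃ * h ^ 3 := by
    refine (le_of_eq ?_).trans e3
    congr 1; linear_combination (9 * h ^ 2 / 8 * p) * hσ2
  have b4 : |h ^ 2 * (X - p)| ≤ C₄ * h ^ 3 := by
    rw [abs_mul, abs_of_pos (by positivity : 0 < h ^ 2)]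
    nlinarith [mul_le_mul_of_nonneg_left e4 (sq_nonneg h), mul_nonneg hC₄ hh3.le]
  have b5 : |h ^ 2 * (Y - r)| ≤ C₅ * h ^ 3 := by
    rw [abs_mul, abs_of_pos (by positivity : 0 < h ^ 2)]
    nlinarith [mul_le_mul_of_nonneg_left e5 (sq_nonneg h), mul_nonneg hC₅ hh3.le]
  have hsum : |(u (1 / 2 + σ * (h / 2)) y - (u (1 / 2) y + σ * h / 2 * a + h ^ 2 / 8 * p))
      - (1 / 2 * (u (1 / 2 + σ * (3 * h / 2)) (y + h) + u (1 / 2 + σ * (3 * h / 2)) (y - h))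
        - (u (1 / 2) y + 3 * σ * h / 2 * a + 9 * h ^ 2 / 8 * p + h ^ 2 / 2 * r))
      + h ^ 2 * (X - p) + h ^ 2 * (Y - r)| ≤ (C₁ + C₃ + C₄ + C₅) * h ^ 3 := by
    rw [abs_le] at *
    constructor <;> linarith
  have hnn : 0 ≤ |c| * (C₁ + C₃ + C₄ + C₅) * h ^ 3 := by positivity
  have hnn1 : 0 ≤ C₁ * h ^ 3 := by positivity
  have hnn2 : 0 ≤ C₂ * h ^ 3 := by positivity
  refine ⟨?_, by linarith, by linarith⟩
  have hcs := mul_le_mul_of_nonneg_left hsum (abs_nonneg c)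
  rw [← abs_mul] at hcs
  rw [← hf]
  refine (le_of_eq ?_).trans (hcs.trans (by linarith))
  congr 1
  ring

/-- The truncation error in the columns `M` and `M + 1` up to third order, in terms of the one-sided
derivatives at the interface: `a, b` stand for `∂ₓu`, `p, q` for `∂ₓ²u` and `r, s` for `∂ᵧ²u`, the
first of each pair from the left and the second from the right. -/
lemma exists_interface_truncError_bound {km ks : ℝ} {f u : ℝ → ℝ → ℝ}
    (hsol : IsInterfaceSolution km f u)
    (h1 : ContDiffOn ℝ 6 (fun p : ℝ × ℝ => u p.1 p.2) (rect 0 (1 / 2)))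
    (h2 : ContDiffOn ℝ 6 (fun p : ℝ × ℝ => u p.1 p.2) (rect (1 / 2) 1)) :
    ∃ C, 0 ≤ C ∧ ∀ M j : ℕ, 1 ≤ M → 1 ≤ j → j ≤ 2 * M → ∀ a b p q r s : ℝ,
      a = partialX (rect 0 (1 / 2)) (fun p => u p.1 p.2) (1 / 2, j * mesh M) →
      b = partialX (rect (1 / 2) 1) (fun p => u p.1 p.2) (1 / 2, j * mesh M) →
      p = partialX (rect 0 (1 / 2)) (partialX (rect 0 (1 / 2)) fun p => u p.1 p.2)
        (1 / 2, j * mesh M) →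
      q = partialX (rect (1 / 2) 1) (partialX (rect (1 / 2) 1) fun p => u p.1 p.2)
        (1 / 2, j * mesh M) →
      r = partialY (rect 0 (1 / 2)) (partialY (rect 0 (1 / 2)) fun p => u p.1 p.2)
        (1 / 2, j * mesh M) →
      s = partialY (rect (1 / 2) 1) (partialY (rect (1 / 2) 1) fun p => u p.1 p.2)
        (1 / 2, j * mesh M) →
      |truncError km ks f u M M j - (mesh M * (km * a - ks * (a + b) / 2)
        + mesh M ^ 2 * (km * r / 2 - ks * s / 2 + ks / 8 * (p - q)))| ≤ C * mesh M ^ 3 ∧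
      |truncError km ks f u M (M + 1) j - (mesh M * (ks * (a + b) / 2 - b)
        + mesh M ^ 2 * (s / 2 - ks * r / 2 + ks / 8 * (q - p)))| ≤ C * mesh M ^ 3 := by
  obtain ⟨C₁, hC₁, H₁⟩ := exists_one_sided_expansion (α := 0) (β := 1 / 2) (σ := -1) (c := km)
    (km := km) (f := f) (Or.inr rfl) (by norm_num)
    (fun s _ _ => by constructor <;> linarith) (fun s _ _ => by constructor <;> linarith) h1
    (fun s hs t => if_pos hs.2) (fun x hx y hy => hsol.equation x y (Or.inl ⟨hx, hy⟩))
  obtain ⟨C₂, hC₂, H₂⟩ := exists_one_sided_expansion (α := 1 / 2) (β := 1) (σ := 1) (c := 1)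
    (km := km) (f := f) (Or.inl rfl) (by norm_num)
    (fun s _ _ => by constructor <;> linarith) (fun s _ _ => by constructor <;> linarith) h2
    (fun s hs t => if_neg (not_lt.2 hs.1.le))
    (fun x hx y hy => hsol.equation x y (Or.inr ⟨hx, hy⟩))
  refine ⟨(1 + |ks|) * (C₁ + C₂), by positivity, ?_⟩
  intro M j hM hj1 hj2 a b p q r s ha hb hp hq hr hs
  have h0 := mesh_pos M
  obtain ⟨hy1, hy2⟩ := node_mem hj1 hj2
  obtain ⟨A1, A2, A3⟩ := H₁ _ _ a p r h0 (mesh_le_third hM) hy1 hy2 ha hp hr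
  obtain ⟨B1, B2, B3⟩ := H₂ _ _ b q s h0 (mesh_le_third hM) hy1 hy2 hb hq hs
  have hc := cells_mul_mesh M
  have kM : cellCoeff km ks M M = km := if_pos le_rfl
  have kM1 : cellCoeff km ks M (M + 1) = ks := by simp [cellCoeff]
  have kM2 : cellCoeff km ks M (M + 1 + 1) = 1 := by simp [cellCoeff]
  set h := mesh M with hh
  have x1 : (M : ℝ) * h = 1 / 2 + -1 * (h / 2) := by linarith
  have x0 : (M : ℝ) * h - h = 1 / 2 + -1 * (3 * h / 2) := by linarith
  have x2 : 1 / 2 + -1 * (h / 2) + h = 1 / 2 + 1 * (h / 2) := by linarith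
  have x3 : 1 / 2 + 1 * (h / 2) + h = 1 / 2 + 1 * (3 * h / 2) := by linarith
  have hn1 : 0 ≤ |ks| * (C₁ * h ^ 3) := by positivity
  have hn2 : 0 ≤ |ks| * (C₂ * h ^ 3) := by positivity
  have hn3 : 0 ≤ C₁ * h ^ 3 := by positivity
  have hn4 : 0 ≤ C₂ * h ^ 3 := by positivity
  have key : ∀ x y z : ℝ, |y| ≤ (C₁ * h ^ 3) + (C₂ * h ^ 3) → z = x + ks * y →
      (|x| ≤ C₁ * h ^ 3 ∨ |x| ≤ C₂ * h ^ 3) → |z| ≤ (1 + |ks|) * (C₁ + C₂) * h ^ 3 := by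
    rintro x y z hy rfl hx
    have hks := mul_le_mul_of_nonneg_left hy (abs_nonneg ks)
    rw [← abs_mul] at hks
    have := abs_add_le x (ks * y)
    rcases hx with hx | hx <;> linarith
  constructor
  · refine key _ (u (1 / 2 + -1 * (h / 2)) (j * h)
        - (u (1 / 2) (j * h) + -1 * h / 2 * a + h ^ 2 / 8 * p)
      - (1 / 2 * (u (1 / 2 + 1 * (h / 2)) (j * h + h) + u (1 / 2 + 1 * (h / 2)) (j * h - h))
        - (u (1 / 2) (j * h) + 1 * h / 2 * b + h ^ 2 / 8 * q + h ^ 2 / 2 * s))) _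
      ((abs_sub _ _).trans (add_le_add A2 B3)) ?_ (Or.inl A1)
    simp only [truncError, Lh, nodal, kM, kM1, cast_pred_mul hM, cast_pred_mul hj1,
      cast_succ_mul, ← hh]
    rw [x0, x1, x2]
    ring
  · refine key _ (u (1 / 2 + 1 * (h / 2)) (j * h)
        - (u (1 / 2) (j * h) + 1 * h / 2 * b + h ^ 2 / 8 * q)
      - (1 / 2 * (u (1 / 2 + -1 * (h / 2)) (j * h + h) + u (1 / 2 + -1 * (h / 2)) (j * h - h))
        - (u (1 / 2) (j * h) + -1 * h / 2 * a + h ^ 2 / 8 * p + h ^ 2 / 2 * r))) _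
      ((abs_sub _ _).trans ((add_le_add B2 A3).trans_eq (add_comm _ _))) ?_ (Or.inr B1)
    simp only [truncError, Lh, nodal, kM1, kM2, Nat.add_sub_cancel, cast_pred_mul hj1,
      cast_succ_mul, ← hh]
    rw [x1, x2, x3]
    ring

/-! ### Error bounds -/

lemma Lh_errorVec {km ks : ℝ} {f u : ℝ → ℝ → ℝ} {M : ℕ} {U : ℕ → ℕ → ℝ}
    (hU : IsSchemeSolution km ks f M U) {i j : ℕ} (hij : (i, j) ∈ S0 M) :
    Lh km ks M (errorVec u M U) i j = truncError km ks f u M i j := by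
  rw [truncError, ← hU.1 i j hij]
  simp only [Lh, errorVec]
  ring

lemma zeroBoundary_errorVec {km ks : ℝ} {f u : ℝ → ℝ → ℝ} {M : ℕ} {U : ℕ → ℕ → ℝ}
    (hsol : IsInterfaceSolution km f u) (hU : IsSchemeSolution km ks f M U) :
    ZeroBoundary M (errorVec u M U) := by
  intro k hk
  have h0 := mesh_pos M
  have hc : (cells M : ℝ) * mesh M = 1 := by
    rw [← cells_mul_mesh M, cells]; push_cast; ring
  have hk' : (k : ℝ) * mesh M ∈ Icc (0 : ℝ) 1 := by
    refine ⟨by positivity, ?_⟩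
    rw [← hc]
    have : (k : ℝ) ≤ cells M := by exact_mod_cast hk
    gcongr
  obtain ⟨b1, b2, b3, b4⟩ := hsol.boundary _ hk'
  obtain ⟨c1, c2, c3, c4⟩ := hU.2 k hk
  simp only [errorVec, nodal, Nat.cast_zero, zero_mul, hc]
  rw [b1, b2, b3, b4, c1, c2, c3, c4]
  simp

/-- Away from the interface the scheme is consistent of second order. -/
lemma exists_SI_truncError_bound {km ks : ℝ} {f u : ℝ → ℝ → ℝ}
    (hsol : IsInterfaceSolution km f u)
    (h1 : ContDiffOn ℝ 6 (fun p : ℝ × ℝ => u p.1 p.2) (rect 0 (1 / 2)))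
    (h2 : ContDiffOn ℝ 6 (fun p : ℝ × ℝ => u p.1 p.2) (rect (1 / 2) 1)) :
    ∃ C, 0 ≤ C ∧ ∀ M i j : ℕ, (i, j) ∈ SI M → |truncError km ks f u M i j| ≤ C * mesh M ^ 4 := by
  obtain ⟨C₁, hC₁, H₁⟩ := exists_truncError_bound (α := 0) (β := 1 / 2) (c := km) (ks := ks)
    (km := km) (f := f) (by norm_num) h1
    (fun s hs t => if_pos hs.2) (fun x hx y hy => hsol.equation x y (Or.inl ⟨hx, hy⟩))
  obtain ⟨C₂, hC₂, H₂⟩ := exists_truncError_bound (α := 1 / 2) (β := 1) (c := 1) (ks := ks)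
    (km := km) (f := f) (by norm_num) h2
    (fun s hs t => if_neg (not_lt.2 hs.1.le))
    (fun x hx y hy => hsol.equation x y (Or.inr ⟨hx, hy⟩))
  refine ⟨C₁ + C₂, by positivity, fun M i j hij => ?_⟩
  have hS := hij.1
  have hB : i ≠ M ∧ i ≠ M + 1 := by
    have := hij.2
    simp only [SB, mem_ofPred_eq] at this
    tauto
  have hS' := mem_S0.1 hS
  have h0 := mesh_pos M
  have hc := cells_mul_mesh M
  obtain ⟨hx1, hx2⟩ := node_mem hS'.1.1 hS'.1.2
  have hn : 0 < mesh M ^ 4 := by positivity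
  rcases lt_or_ge i M with hi | hi
  · have hi' : (i : ℝ) + 1 ≤ M := by exact_mod_cast hi
    refine (H₁ M i j hS (by linarith) (by nlinarith) (if_pos hi.le) (if_pos hi)).trans ?_
    gcongr
    linarith
  · have hi' : (M : ℝ) + 2 ≤ i := by exact_mod_cast (show M + 2 ≤ i by omega)
    refine (H₂ M i j hS (by nlinarith) (by linarith) ?_ ?_).trans ?_
    · rw [cellCoeff, if_neg (by omega), if_neg (by omega)]
    · rw [cellCoeff, if_neg (by omega), if_neg (by omega)]
    · gcongr
      linarith

/-- The first part of the error vanishes next to the interface, so that only the consistency error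
of second order enters the stability bound. -/
lemma exists_firstErrorPart_bound {km ks : ℝ} (hkm : 1 ≤ km) (hks : 0 < ks) {f u : ℝ → ℝ → ℝ}
    (hsol : IsInterfaceSolution km f u) (hW : MemW u) :
    ∃ C, 0 ≤ C ∧ ∀ M : ℕ, ∀ e₁ : ℕ → ℕ → ℝ, IsFirstErrorPart km ks f u M e₁ →
      ∀ i ≤ cells M, ∀ j ≤ cells M, |e₁ i j| ≤ C * mesh M ^ 2 := by
  obtain ⟨C, hC, H⟩ := exists_SI_truncError_bound (ks := ks) hsol (closure_D1 ▸ hW.1)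
    (closure_D2 ▸ hW.2)
  have hb : 0 < barrierBound ks := by
    have : 0 < min 1 ks := lt_min one_pos hks
    unfold barrierBound; positivity
  refine ⟨C * barrierBound ks, by positivity, fun M e he i hi j hj => ?_⟩
  have h0 := mesh_pos M
  have hA : 0 ≤ C * mesh M ^ 2 := by positivity
  have := abs_le_of_abs_Lh_le hkm hks (M := M) (v := e) hA (fun k hk => ?_)
    (fun i j hij => ?_) hi hj
  · linarith
  · obtain ⟨b1, b2, b3, b4⟩ := he.2.2 k hk
    rw [b1, b2, b3, b4, abs_zero]
    exact ⟨hA, hA, hA, hA⟩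
  · by_cases hB : (i, j) ∈ SB M
    · left
      rw [he.2.1 i j hB, abs_zero]
      exact hA
    · right
      have hI : (i, j) ∈ SI M := ⟨hij, hB⟩
      rw [he.1 i j hI, residualScale, if_neg fun h => hB ⟨hij, h⟩]
      refine (H M i j hI).trans_eq ?_
      ring

/-- The traces on the interface that occur as dipole densities have second differences of order
`h²`, uniformly in the mesh. -/
lemma exists_nodal_second_difference_bound {α β : ℝ} (hαβ : α < β) (h2 : (1 / 2 : ℝ) ∈ Icc α β)
    {g : ℝ × ℝ → ℝ} (hg : ContDiffOn ℝ 2 g (rect α β)) :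
    ∃ C, 0 ≤ C ∧ ∀ M : ℕ, (∀ j ≤ cells M, |g (1 / 2, j * mesh M)| ≤ C) ∧
      ∀ j, 1 ≤ j → j ≤ 2 * M → |g (1 / 2, (j + 1 : ℕ) * mesh M) + g (1 / 2, (j - 1 : ℕ) * mesh M)
        - 2 * g (1 / 2, j * mesh M)| ≤ C * mesh M ^ 2 := by
  obtain ⟨C₁, hC₁, H₁⟩ := exists_abs_le (isCompact_rect α β) hg.continuousOn
  obtain ⟨C₂, hC₂, H₂⟩ := exists_taylor_bound (isCompact_rect α β) (convex_rect α β)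
    (uniqueDiffOn_rect hαβ) ((0 : ℝ), (1 : ℝ)) 2 g (by exact_mod_cast hg)
  refine ⟨C₁ + 2 * C₂, by positivity, fun M => ⟨fun j hj => ?_, fun j hj1 hj2 => ?_⟩⟩
  · have h0 := mesh_pos M
    have hc := cells_mul_mesh M
    have hj' : (j : ℝ) ≤ 2 * M + 1 := by exact_mod_cast hj
    refine (H₁ _ ⟨h2, by positivity, ?_⟩).trans (by linarith)
    simp only
    nlinarith
  · have h0 := mesh_pos M
    obtain ⟨hy1, hy2⟩ := node_mem hj1 hj2
    rw [cast_pred_mul hj1, cast_succ_mul]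
    set h := mesh M
    set y := (j : ℝ) * h
    have p1 : ((1 / 2 : ℝ), y) + h • ((0 : ℝ), (1 : ℝ)) = (1 / 2, y + h) := by simp
    have p2 : ((1 / 2 : ℝ), y) + (-h) • ((0 : ℝ), (1 : ℝ)) = (1 / 2, y - h) := by
      simp [sub_eq_add_neg]
    have hp : ((1 / 2 : ℝ), y) ∈ rect α β := ⟨h2, by constructor <;> simp only <;> linarith⟩
    have e1 := H₂ _ hp h (by rw [p1]; exact ⟨h2, by constructor <;> simp only <;> linarith⟩)
    have e2 := H₂ _ hp (-h) (by rw [p2]; exact ⟨h2, by constructor <;> simp only <;> linarith⟩)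
    rw [p1, sq_abs] at e1
    rw [p2, sq_abs] at e2
    simp only [Finset.sum_range_succ, Finset.sum_range_zero, Nat.factorial,
      Function.iterate_succ_apply, Function.iterate_zero, id] at e1 e2
    have hn : 0 ≤ C₁ * h ^ 2 := by positivity
    rw [abs_le] at *
    constructor <;> ring_nf at * <;> linarith

lemma pow_le_pow_mesh (M : ℕ) {k l : ℕ} (hkl : k ≤ l) : mesh M ^ l ≤ mesh M ^ k := by
  have h0 := mesh_pos M
  have h1 := cells_mul_mesh M
  exact pow_le_pow_of_le_one h0.le (by nlinarith [mul_nonneg (Nat.cast_nonneg (α := ℝ) M) h0.le])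
    hkl

/-- If the truncation error next to the interface is, up to higher-order terms, a dipole of size
`hᵏ` with a smooth density, then the scheme converges with order `k`. -/
lemma exists_errorVec_bound_of_dipole {km ks : ℝ} (hkm : 1 ≤ km) (hks : 0 < ks)
    {f u : ℝ → ℝ → ℝ} (hsol : IsInterfaceSolution km f u) (hW : MemW u) {k : ℕ} (hk : k ≤ 2)
    {d : ℝ → ℝ} {A : ℝ} (hA : 0 ≤ A)
    (hd : ∀ M : ℕ, (∀ j ≤ cells M, |d (j * mesh M)| ≤ A) ∧
      ∀ j, 1 ≤ j → j ≤ 2 * M → |d ((j + 1 : ℕ) * mesh M) + d ((j - 1 : ℕ) * mesh M)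
        - 2 * d (j * mesh M)| ≤ A * mesh M ^ 2)
    (hR : ∀ M j : ℕ, 1 ≤ M → 1 ≤ j → j ≤ 2 * M →
      |truncError km ks f u M M j + mesh M ^ k * d (j * mesh M)| ≤ A * mesh M ^ (k + 1) ∧
      |truncError km ks f u M (M + 1) j - mesh M ^ k * d (j * mesh M)| ≤ A * mesh M ^ (k + 1)) :
    ∃ C, 0 ≤ C ∧ ∀ M : ℕ, 1 ≤ M → ∀ U : ℕ → ℕ → ℝ, IsSchemeSolution km ks f M U →
      ∀ i ≤ cells M, ∀ j ≤ cells M, |errorVec u M U i j| ≤ C * mesh M ^ k := by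
  obtain ⟨B, hB, HB⟩ := exists_SI_truncError_bound (ks := ks) hsol (closure_D1 ▸ hW.1)
    (closure_D2 ▸ hW.2)
  obtain ⟨C, H⟩ := abs_le_of_dipole hkm hks (add_nonneg hA hB)
  refine ⟨max C 0, le_max_right _ _, fun M hM U hU i hi j hj => ?_⟩
  have h0 := mesh_pos M
  have hle : ∀ n : ℕ, A * mesh M ^ n ≤ (A + B) * mesh M ^ n := fun n =>
    mul_le_mul_of_nonneg_right (by linarith) (by positivity)
  refine (H k M (errorVec u M U) (fun j => d (j * mesh M)) (zeroBoundary_errorVec hsol hU)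
    (fun j hj => ((hd M).1 j hj).trans (by linarith))
    (fun j hj1 hj2 => ((hd M).2 j hj1 hj2).trans (hle 2)) (fun i j hij => ?_)
    (fun j hj1 hj2 => ?_) (fun j hj1 hj2 => ?_) i hi j hj).trans ?_
  · rw [Lh_errorVec hU hij.1]
    refine (HB M i j hij).trans ?_
    exact mul_le_mul (by linarith) (pow_le_pow_mesh M (by omega)) (by positivity) (by linarith)
  · rw [Lh_errorVec hU (mem_S0.2 ⟨⟨hM, by omega⟩, hj1, hj2⟩)]
    exact (hR M j hM hj1 hj2).1.trans (hle _)
  · rw [Lh_errorVec hU (mem_S0.2 ⟨⟨by omega, by omega⟩, hj1, hj2⟩)]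
    exact (hR M j hM hj1 hj2).2.trans (hle _)
  · gcongr
    exact le_max_left _ _

/-- The scheme converges with order one: by continuity of the flux the leading part of the
truncation error next to the interface is a dipole. -/
lemma exists_errorVec_bound {km ks : ℝ} (hkm : 1 ≤ km) (hks : 0 < ks) {f u : ℝ → ℝ → ℝ}
    (hsol : IsInterfaceSolution km f u) (hW : MemW u) :
    ∃ C, 0 ≤ C ∧ ∀ M : ℕ, 1 ≤ M → ∀ U : ℕ → ℕ → ℝ, IsSchemeSolution km ks f M U →
      ∀ i ≤ cells M, ∀ j ≤ cells M, |errorVec u M U i j| ≤ C * mesh M := by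
  have h1 : ContDiffOn ℝ 6 (fun p : ℝ × ℝ => u p.1 p.2) (rect 0 (1 / 2)) := closure_D1 ▸ hW.1
  have h2 : ContDiffOn ℝ 6 (fun p : ℝ × ℝ => u p.1 p.2) (rect (1 / 2) 1) := closure_D2 ▸ hW.2
  have hU1 := uniqueDiffOn_rect (show (0 : ℝ) < 1 / 2 by norm_num)
  have hU2 := uniqueDiffOn_rect (show (1 / 2 : ℝ) < 1 by norm_num)
  have s1 := fun v => contDiffOn_dirDeriv hU1 (n := 5) (by exact_mod_cast h1) v
  have s2 := fun v => contDiffOn_dirDeriv hU2 (n := 5) (by exact_mod_cast h2) v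
  obtain ⟨B₁, hB₁, hp⟩ := exists_abs_le (isCompact_rect _ _) (contDiffOn_dirDeriv hU1 (n := 4)
    (s1 ((1 : ℝ), (0 : ℝ))) ((1 : ℝ), (0 : ℝ))).continuousOn
  obtain ⟨B₂, hB₂, hq⟩ := exists_abs_le (isCompact_rect _ _) (contDiffOn_dirDeriv hU2 (n := 4)
    (s2 ((1 : ℝ), (0 : ℝ))) ((1 : ℝ), (0 : ℝ))).continuousOn
  obtain ⟨B₃, hB₃, hr⟩ := exists_abs_le (isCompact_rect _ _) (contDiffOn_dirDeriv hU1 (n := 4)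
    (s1 ((0 : ℝ), (1 : ℝ))) ((0 : ℝ), (1 : ℝ))).continuousOn
  obtain ⟨B₄, hB₄, hs⟩ := exists_abs_le (isCompact_rect _ _) (contDiffOn_dirDeriv hU2 (n := 4)
    (s2 ((0 : ℝ), (1 : ℝ))) ((0 : ℝ), (1 : ℝ))).continuousOn
  obtain ⟨A, hA, HA⟩ := exists_nodal_second_difference_bound (by norm_num) (by norm_num)
    ((s1 ((1 : ℝ), (0 : ℝ))).of_le (by norm_num))
  obtain ⟨C, hC, H⟩ := exists_interface_truncError_bound (ks := ks) hsol h1 h2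
  set a : ℝ → ℝ := fun y => partialX (rect 0 (1 / 2)) (fun p => u p.1 p.2) (1 / 2, y) with ha
  -- The density of the dipole: the left derivative times the mismatch of the coefficient in the
  -- cut cells, which is zero for the harmonic average.
  set c := ks * (1 + km) / 2 - km with hc
  set B := B₁ + B₂ + B₃ + B₄
  have hB : 0 ≤ B := by positivity
  have hB' : B = B₁ + B₂ + B₃ + B₄ := rfl
  clear_value B c
  have key : ∀ x y : ℝ, 0 ≤ x → |y| ≤ B → |x * y| ≤ x * B := fun x y hx hy => by
    rw [abs_mul, abs_of_nonneg hx]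
    exact mul_le_mul_of_nonneg_left hy hx
  have := exists_errorVec_bound_of_dipole hkm hks hsol hW (k := 1) (by norm_num)
    (d := fun y => c * a y) (A := |c| * A + (C + (km + ks) * B)) (by positivity)
    (fun M => ⟨fun j hj => ?_, fun j hj1 hj2 => ?_⟩) (fun M j hM hj1 hj2 => ?_)
  · simpa only [pow_one] using this
  · rw [abs_mul]
    have := mul_le_mul_of_nonneg_left ((HA M).1 j hj) (abs_nonneg c)
    have h3 : 0 ≤ C + (km + ks) * B := by positivity
    linarith
  · have h3 := mul_le_mul_of_nonneg_left ((HA M).2 j hj1 hj2) (abs_nonneg c)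
    rw [← abs_mul] at h3
    have h0 := mesh_pos M
    have h4 : 0 ≤ (C + (km + ks) * B) * mesh M ^ 2 := by positivity
    refine (le_of_eq ?_).trans (h3.trans (by linarith))
    congr 1
    simp only [ha]
    ring
  · have h0 := mesh_pos M
    obtain ⟨hy1, hy2⟩ := node_mem hj1 hj2
    have hyi : (j : ℝ) * mesh M ∈ Ioo (0 : ℝ) 1 := ⟨by linarith, by linarith⟩
    have hyc : (j : ℝ) * mesh M ∈ Icc (0 : ℝ) 1 := Ioo_subset_Icc_self hyi
    obtain ⟨R1, R2⟩ := H M j hM hj1 hj2 _ _ _ _ _ _ rfl rfl rfl rfl rfl rfl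
    rw [flux_eq h1 h2 hsol.jump_flux hyi] at R1 R2
    have m1 : ((1 / 2 : ℝ), (j : ℝ) * mesh M) ∈ rect 0 (1 / 2) := ⟨by norm_num, hyc⟩
    have m2 : ((1 / 2 : ℝ), (j : ℝ) * mesh M) ∈ rect (1 / 2) 1 := ⟨by norm_num, hyc⟩
    have bp := (hp _ m1).trans (show B₁ ≤ B by linarith)
    have bq := (hq _ m2).trans (show B₂ ≤ B by linarith)
    have br := (hr _ m1).trans (show B₃ ≤ B by linarith)
    have bs := (hs _ m2).trans (show B₄ ≤ B by linarith)
    simp only [ha, partialX, partialY] at *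
    generalize dirDeriv (rect 0 (1 / 2)) (1, 0) (dirDeriv (rect 0 (1 / 2)) (1, 0)
      fun p => u p.1 p.2) (1 / 2, j * mesh M) = p at *
    generalize dirDeriv (rect (1 / 2) 1) (1, 0) (dirDeriv (rect (1 / 2) 1) (1, 0)
      fun p => u p.1 p.2) (1 / 2, j * mesh M) = q at *
    generalize dirDeriv (rect 0 (1 / 2)) (0, 1) (dirDeriv (rect 0 (1 / 2)) (0, 1)
      fun p => u p.1 p.2) (1 / 2, j * mesh M) = r at *
    generalize dirDeriv (rect (1 / 2) 1) (0, 1) (dirDeriv (rect (1 / 2) 1) (0, 1)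
      fun p => u p.1 p.2) (1 / 2, j * mesh M) = s at *
    generalize dirDeriv (rect 0 (1 / 2)) (1, 0) (fun p => u p.1 p.2) (1 / 2, j * mesh M) = a at *
    have hpow : C * mesh M ^ 3 ≤ C * mesh M ^ 2 :=
      mul_le_mul_of_nonneg_left (pow_le_pow_mesh M (by norm_num)) hC
    have hcA : 0 ≤ |c| * A * mesh M ^ 2 := by positivity
    have k1 := key _ _ (by linarith : (0 : ℝ) ≤ km) br
    have k2 := key _ _ hks.le bs
    have k3 := key _ _ hks.le bp
    have k4 := key _ _ hks.le bq
    have k5 := key _ _ hks.le br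
    have hkB : B ≤ km * B := le_mul_of_one_le_left hB hkm
    have hkB' : 0 ≤ ks * B := by positivity
    have S1 : |km * r / 2 - ks * s / 2 + ks / 8 * (p - q)| ≤ (km + ks) * B := by
      rw [abs_le] at *
      constructor <;> linarith
    have S2 : |s / 2 - ks * r / 2 + ks / 8 * (q - p)| ≤ (km + ks) * B := by
      rw [abs_le] at *
      constructor <;> linarith
    have T1 := mul_le_mul_of_nonneg_left S1 (sq_nonneg (mesh M))
    have T2 := mul_le_mul_of_nonneg_left S2 (sq_nonneg (mesh M))
    rw [← abs_of_nonneg (sq_nonneg (mesh M)), ← abs_mul, abs_of_nonneg (sq_nonneg (mesh M))]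
      at T1 T2
    constructor
    · refine le_trans (le_of_eq ?_) ((abs_add_le _ _).trans ((add_le_add R1 T1).trans ?_))
      · congr 1
        rw [hc]
        ring
      · rw [one_add_one_eq_two]
        linarith
    · refine le_trans (le_of_eq ?_) ((abs_add_le _ _).trans ((add_le_add R2 T2).trans ?_))
      · congr 1
        rw [hc]
        ring
      · rw [one_add_one_eq_two]
        linarith

/-- Under Assumption I the dipole of order one disappears with the harmonic average, and the
second-order part of the truncation error next to the interface is again a dipole. -/
lemma exists_errorVec_bound_of_assumptionI {km ks : ℝ} (hkm : 1 ≤ km) (hks : 0 < ks)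
    {f u : ℝ → ℝ → ℝ} (hsol : IsInterfaceSolution km f u) (hW : MemW u)
    (hA : AssumptionI km ks u) :
    ∃ C, 0 ≤ C ∧ ∀ M : ℕ, 1 ≤ M → ∀ U : ℕ → ℕ → ℝ, IsSchemeSolution km ks f M U →
      ∀ i ≤ cells M, ∀ j ≤ cells M, |errorVec u M U i j| ≤ C * mesh M ^ 2 := by
  have h1 : ContDiffOn ℝ 6 (fun p : ℝ × ℝ => u p.1 p.2) (rect 0 (1 / 2)) := closure_D1 ▸ hW.1
  have h2 : ContDiffOn ℝ 6 (fun p : ℝ × ℝ => u p.1 p.2) (rect (1 / 2) 1) := closure_D2 ▸ hW.2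
  have hU1 := uniqueDiffOn_rect (show (0 : ℝ) < 1 / 2 by norm_num)
  have hU2 := uniqueDiffOn_rect (show (1 / 2 : ℝ) < 1 by norm_num)
  have s1 := contDiffOn_dirDeriv hU1 (n := 4) (contDiffOn_dirDeriv hU1 (n := 5)
    (by exact_mod_cast h1) ((1 : ℝ), (0 : ℝ))) ((1 : ℝ), (0 : ℝ))
  have s2 := contDiffOn_dirDeriv hU2 (n := 4) (contDiffOn_dirDeriv hU2 (n := 5)
    (by exact_mod_cast h2) ((1 : ℝ), (0 : ℝ))) ((1 : ℝ), (0 : ℝ))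
  obtain ⟨A₁, hA₁, HA₁⟩ := exists_nodal_second_difference_bound (by norm_num) (by norm_num)
    (s1.of_le (by norm_num))
  obtain ⟨A₂, hA₂, HA₂⟩ := exists_nodal_second_difference_bound (by norm_num) (by norm_num)
    (s2.of_le (by norm_num))
  obtain ⟨C, hC, H⟩ := exists_interface_truncError_bound (ks := ks) hsol h1 h2
  set p : ℝ → ℝ := fun y => dirDeriv (rect 0 (1 / 2)) (1, 0) (dirDeriv (rect 0 (1 / 2)) (1, 0)
      fun p => u p.1 p.2) (1 / 2, y) with hp
  set q : ℝ → ℝ := fun y => dirDeriv (rect (1 / 2) 1) (1, 0) (dirDeriv (rect (1 / 2) 1) (1, 0)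
      fun p => u p.1 p.2) (1 / 2, y) with hq
  have key : ∀ x y e : ℝ, 0 ≤ e → |x| ≤ A₁ * e → |y| ≤ A₂ * e →
      |-(ks / 8) * (x - y)| ≤ (ks / 8 * (A₁ + A₂) + C) * e := by
    intro x y e he hx hy
    rw [abs_mul, abs_neg, abs_of_pos (by positivity : 0 < ks / 8)]
    have h3 := mul_le_mul_of_nonneg_left ((abs_sub x y).trans (add_le_add hx hy))
      (by positivity : 0 ≤ ks / 8)
    have h4 : 0 ≤ C * e := by positivity
    linarith
  refine exists_errorVec_bound_of_dipole hkm hks hsol hW (k := 2) le_rfl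
    (d := fun y => -(ks / 8) * (p y - q y)) (A := ks / 8 * (A₁ + A₂) + C) (by positivity)
    (fun M => ⟨fun j hj => ?_, fun j hj1 hj2 => ?_⟩) (fun M j hM hj1 hj2 => ?_)
  · have := key _ _ 1 zero_le_one (((HA₁ M).1 j hj).trans_eq (mul_one _).symm)
      (((HA₂ M).1 j hj).trans_eq (mul_one _).symm)
    rwa [mul_one] at this
  · refine (le_of_eq ?_).trans (key _ _ _ (sq_nonneg (mesh M)) ((HA₁ M).2 j hj1 hj2)
      ((HA₂ M).2 j hj1 hj2))
    congr 1
    simp only [hp, hq]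
    ring
  · have h0 := mesh_pos M
    obtain ⟨hy1, hy2⟩ := node_mem hj1 hj2
    have hyi : (j : ℝ) * mesh M ∈ Ioo (0 : ℝ) 1 := ⟨by linarith, by linarith⟩
    obtain ⟨R1, R2⟩ := H M j hM hj1 hj2 _ _ _ _ _ _ rfl rfl rfl rfl rfl rfl
    obtain ⟨hr, hs⟩ := partialY_partialY_eq_zero h1 h2 hA hyi
    rw [flux_eq h1 h2 hsol.jump_flux hyi, hr, hs] at R1 R2
    have hkm1 : km + 1 ≠ 0 := by linarith
    have hks1 : ks * (km + 1) = 2 * km := by rw [hA.1]; field_simp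
    have hle : C * mesh M ^ 3 ≤ (ks / 8 * (A₁ + A₂) + C) * mesh M ^ (2 + 1) := by
      have : 0 ≤ ks / 8 * (A₁ + A₂) * mesh M ^ 3 := by positivity
      linarith
    set a := partialX (rect 0 (1 / 2)) (fun p => u p.1 p.2) (1 / 2, j * mesh M)
    constructor
    · refine (le_of_eq ?_).trans (R1.trans hle)
      congr 1
      simp only [hp, hq]
      linear_combination -(mesh M * a / 2) * hks1
    · refine (le_of_eq ?_).trans (R2.trans hle)
      congr 1
      simp only [hp, hq]
      linear_combination (mesh M * a / 2) * hks1

lemma maxNorm_le {M : ℕ} {v : ℕ → ℕ → ℝ} {A : ℝ}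
    (h : ∀ i ≤ cells M, ∀ j ≤ cells M, |v i j| ≤ A) : maxNorm M v ≤ A := by
  refine Finset.sup'_le _ _ fun p hp => ?_
  simp only [Finset.mem_product, Finset.mem_range] at hp
  exact h _ (by omega) _ (by omega)

end MachFVM

theorem mainTheorem4 (km ks : ℝ) (hkm : 1 ≤ km) (hks : 0 < ks) (f u : ℝ → ℝ → ℝ)
    (hsol : MachFVM.IsInterfaceSolution km f u) (hW : MachFVM.MemW u) :
    (∃ C : ℝ, ∀ M : ℕ, 1 ≤ M → ∀ U e₁ e₂ : ℕ → ℕ → ℝ,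
      MachFVM.IsSchemeSolution km ks f M U →
      MachFVM.IsFirstErrorPart km ks f u M e₁ →
      MachFVM.errorVec u M U = e₁ + e₂ →
      MachFVM.maxNorm M e₁ ≤ C * (MachFVM.mesh M ^ 2 * |Real.log (MachFVM.mesh M)|) ∧
      MachFVM.maxNorm M e₂ ≤ C * (MachFVM.mesh M * |Real.log (MachFVM.mesh M)|)) ∧
    (MachFVM.AssumptionI km ks u →
      ∃ C : ℝ, ∀ M : ℕ, 1 ≤ M → ∀ U e₁ e₂ : ℕ → ℕ → ℝ,
        MachFVM.IsSchemeSolution km ks f M U →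
        MachFVM.IsFirstErrorPart km ks f u M e₁ →
        MachFVM.errorVec u M U = e₁ + e₂ →
        MachFVM.maxNorm M e₂ ≤ C * (MachFVM.mesh M ^ 2 * |Real.log (MachFVM.mesh M)|)) := by
  obtain ⟨C₁, hC₁, H₁⟩ := MachFVM.exists_firstErrorPart_bound hkm hks hsol hW
  -- The second part inherits the bounds of the whole error, since the first part is `O(h²)`.
  have split : ∀ {M : ℕ} {U e₁ e₂ : ℕ → ℕ → ℝ}, MachFVM.errorVec u M U = e₁ + e₂ → ∀ i j,
      |e₂ i j| ≤ |MachFVM.errorVec u M U i j| + |e₁ i j| := by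
    intro M U e₁ e₂ h i j
    have : e₂ i j = MachFVM.errorVec u M U i j - e₁ i j := by rw [h]; simp
    rw [this]
    exact abs_sub _ _
  -- The logarithm only weakens the bounds, as `|log h| ≥ 1` for `h ≤ 1/3`.
  have hlog : ∀ {M : ℕ} {C x : ℝ}, 1 ≤ M → 0 ≤ C → 0 ≤ x →
      C * x ≤ C * (x * |Real.log (MachFVM.mesh M)|) := fun hM hC hx =>
    mul_le_mul_of_nonneg_left (le_mul_of_one_le_right hx (MachFVM.one_le_abs_log_mesh hM)) hC
  constructor
  · obtain ⟨C₂, hC₂, H₂⟩ := MachFVM.exists_errorVec_bound hkm hks hsol hW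
    refine ⟨C₁ + C₂, fun M hM U e₁ e₂ hU he₁ he => ?_⟩
    have h0 := MachFVM.mesh_pos M
    have hpow := MachFVM.pow_le_pow_mesh M (show 1 ≤ 2 by norm_num)
    rw [pow_one] at hpow
    refine ⟨MachFVM.maxNorm_le fun i hi j hj => ?_, MachFVM.maxNorm_le fun i hi j hj => ?_⟩
    · refine ((H₁ M e₁ he₁ i hi j hj).trans ?_).trans (hlog hM (by positivity) (by positivity))
      gcongr
      linarith
    · refine ((split he i j).trans ?_).trans (hlog hM (by positivity) h0.le)
      have b1 := H₁ M e₁ he₁ i hi j hj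
      have b2 := H₂ M hM U hU i hi j hj
      linarith [mul_le_mul_of_nonneg_left hpow hC₁]
  · intro hA
    obtain ⟨C₂, hC₂, H₂⟩ := MachFVM.exists_errorVec_bound_of_assumptionI hkm hks hsol hW hA
    refine ⟨C₁ + C₂, fun M hM U e₁ e₂ hU he₁ he => MachFVM.maxNorm_le fun i hi j hj => ?_⟩
    have h0 := MachFVM.mesh_pos M
    refine ((split he i j).trans ?_).trans (hlog hM (by positivity) (by positivity))
    linarith [H₁ M e₁ he₁ i hi j hj, H₂ M hM U hU i hi j hj]
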